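/- **Notation.** Let $\mu,\varepsilon,\nu,\omega,x\in\mathbb C$, $\mu\neq0$ (the parameters and variable of the grand confluent hypergeometric (GCH) equation $xy''+(\mu x^2+\varepsilon x+\nu)y'+(\Omega x+\varepsilon\omega)y=0$), and put $\gamma=\frac12(1+\nu)$, $\tilde\varepsilon=-\frac12\varepsilon x$, $z=-\frac12\mu x^2$. Let $(a)_n=a(a+1)\cdots(a+n-1)$; complex powers are principal. Let $$F_b(\gamma;w)=\tfrac{\Gamma(b+\gamma)}{\Gamma(\gamma)}\sum_{n=0}^{b}\tfrac{(-b)_n}{(\gamma)_n n!}w^n,\quad A_b(\gamma;w)=\tfrac{\Gamma(b+2-\gamma)}{\Gamma(2-\gamma)}\sum_{n=0}^{b}\tfrac{(-b)_n}{(2-\gamma)_n n!}w^n,\quad M(a,b,w)=\sum_{n\ge0}\tfrac{(a)_n}{(b)_n n!}w^n .$$ *Power series.* For $\lambda\in\{0,\,2(1-\gamma)\}$ and a sequence $(a_k)_{k\ge0}$ put $$b_k(i)=\frac{i+\frac\lambda2+\frac\omega2+\frac k2}{(i+\frac12+\frac\lambda2+\frac k2)(i-\frac12+\gamma+\frac k2+\frac\lambda2)},\qquad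 \rho_k(i,j)=\frac{(a_k)_j\,(1+\frac k2+\frac\lambda2)_i\,(\frac k2+\gamma+\frac\lambda2)_i}{(a_k)_i\,(1+\frac k2+\frac\lambda2)_j\,(\frac k2+\gamma+\frac\lambda2)_j},$$ $\sigma(i)=\frac{(a_0)_i}{(1+\lambda/2)_i(\gamma+\lambda/2)_i}$, and let $$S_0=\sum_{i_0}\sigma(i_0)z^{i_0},\qquad S_n=\sum_{i_0}b_0(i_0)\sigma(i_0)\sum_{i_1\ge i_0}b_1(i_1)\rho_1(i_0,i_1)\cdots\sum_{i_{n-1}\ge i_{n-2}}b_{n-1}(i_{n-1})\rho_{n-1}(i_{n-2},i_{n-1})\sum_{i_n\ge i_{n-1}}\rho_n(i_{n-1},i_n)z^{i_n}.$$ In the *polynomial case*, $a_k=-\beta_k$ with non-negative integers $\beta_0\le\beta_1\le\cdots$, and $i_k$ runs up to $\beta_k$; in the *infinite series case*, $a_k=\frac{\Omega}{2\mu}+\frac k2+\frac\lambda2$ and all $i_k$ run to $\infty$. The GCH functions are the series * $QW_{\beta_i}=\frac{\Gamma(\beta_0+\gamma)}{\Gamma(\gamma)}\sum_n S_n\tilde\varepsilon^n$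 (polynomial case, $\lambda=0$, $\Omega_i=-2\mu(\beta_i+\frac i2)$), * $RW_{\psi_i}=z^{1-\gamma}\frac{\Gamma(\psi_0+2-\gamma)}{\Gamma(2-\gamma)}\sum_n S_n\tilde\varepsilon^n$ (polynomial case with $\beta=\psi$, $\lambda=2(1-\gamma)$, $\Omega_i=-2\mu(\psi_i+1-\gamma+\frac i2)$), * $QW=\frac{\Gamma(\gamma-\frac\Omega{2\mu})}{\Gamma(\gamma)}\sum_n S_n\tilde\varepsilon^n$ (infinite series, $\lambda=0$), * $RW=z^{1-\gamma}\frac{\Gamma(1-\frac\Omega{2\mu})}{\Gamma(2-\gamma)}\sum_n S_n\tilde\varepsilon^n$ (infinite series, $\lambda=2(1-\gamma)$). *Integral operators.* For an entire function $f$ let $\mathcal I_0f=f$ and, for $m\ge1$, $$(\mathcal I_mf)(w)=\int_0^1\!dt\;t^{\frac m2-1+\frac\lambda2}\int_0^1\!du\;u^{\gamma+\frac m2-2+\frac\lambda2}\;\frac1{2\pi i}\oint dv\,\frac{\exp\left(-\frac{v}{1-v}w(1-t)(1-u)\right)}{v^{\kappa_m+1}(1-v)}\;\Big[\Big(s\,\partial_s+\tfrac12(m-1+\omega+\lambda)\Big)(\mathcal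 I_{m-1}f)(s)\Big]_{s=wtuv}.$$ So $(\mathcal I_nf)(z)$ is the $n$-fold nested integral with variables $t_n,u_n,v_n,\dots,t_1,u_1,v_1$ from the outside to the inside and $w_{m,n}=z\prod_{l=m}^nt_lu_lv_l$, ending in $f(w_{1,n})$. In the polynomial case $\kappa_m=\beta_m$ and the contour is a counterclockwise circle $|v|=r_m$; in the infinite series case $\kappa_m=-(\frac\Omega{2\mu}+\frac m2+\frac\lambda2)$ and the contour is a clockwise circle $|v-1|=r_m$. The radii $r_m\in(0,1)$ are arbitrary. **Statement.** In each case below all derivatives and integrals in $\mathcal I_nf$ exist. 1. (First kind polynomial.) Let $\operatorname{Re}\gamma>\frac12$ and let $\beta_0\le\beta_1\le\cdots$ be non-negative integers, $\Omega_i=-2\mu(\beta_i+\frac i2)$. With $\lambda=0$ and $f=F_{\beta_0}(\gamma;\cdot)$, $$QW_{\beta_i}=F_{\beta_0}(\gamma;z)+\sum_{n=1}^\infty(\mathcal I_nf)(z)\,\tilde\varepsilon^n .$$ 2. (Second kind polynomial.) Let $\operatorname{Re}\gamma<\frac32$ and let $\psi_0\le\psi_1\le\cdots$ be non-negative integers,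 $\Omega_i=-2\mu(\psi_i+1-\gamma+\frac i2)$. With $\lambda=2(1-\gamma)$, $\beta=\psi$ and $f=A_{\psi_0}(\gamma;\cdot)$, $$RW_{\psi_i}=z^{1-\gamma}\Big\{A_{\psi_0}(\gamma;z)+\sum_{n=1}^\infty(\mathcal I_nf)(z)\,\tilde\varepsilon^n\Big\}.$$ 3. (First kind infinite series.) Let $\operatorname{Re}\gamma>\frac12$, $\gamma-\frac\Omega{2\mu}\notin\{0,-1,-2,\dots\}$, and $\frac\Omega{2\mu}+\frac k2\notin\{0,-1,-2,\dots\}$ for all $k\ge1$. With $\lambda=0$ and $f=M(\frac\Omega{2\mu},\gamma,\cdot)$, $$QW=\tfrac{\Gamma(\gamma-\frac\Omega{2\mu})}{\Gamma(\gamma)}\Big\{M\big(\tfrac\Omega{2\mu},\gamma,z\big)+\sum_{n=1}^\infty(\mathcal I_nf)(z)\,\tilde\varepsilon^n\Big\}.$$ 4. (Second kind infinite series.) Let $\operatorname{Re}\gamma<\frac32$, $1-\frac\Omega{2\mu}\notin\{0,-1,-2,\dots\}$, and $\frac\Omega{2\mu}+1-\gamma+\frac k2\notin\{0,-1,-2,\dots\}$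 for all $k\ge1$. With $\lambda=2(1-\gamma)$ and $f=M(\frac\Omega{2\mu}+1-\gamma,2-\gamma,\cdot)$, $$RW=z^{1-\gamma}\tfrac{\Gamma(1-\frac\Omega{2\mu})}{\Gamma(2-\gamma)}\Big\{M\big(\tfrac\Omega{2\mu}+1-\gamma,2-\gamma,z\big)+\sum_{n=1}^\infty(\mathcal I_nf)(z)\,\tilde\varepsilon^n\Big\}.$$ In all four cases the terms of index $n$ of the two sides agree for every $n\ge 0$. In 1 and 2 the identity means in addition that, as series, one side converges exactly when the other does (in 2 provided $z^{1-\gamma}\ne0$; if $z^{1-\gamma}=0$, convergence of the right-hand series still implies the identity), with the equal values above; the terms of $QW_{\beta_i}$, $RW_{\psi_i}$ are absolutely summable when the sequence $\beta$, resp. $\psi$, is bounded. In 3 and 4 all nested sums defining $S_n$ and all series over $n$ converge absolutely. -/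

import Mathlib

open Filter Topology MeasureTheory

noncomputable section

namespace GCH

/-- Rising factorial `(a)_n = a (a+1) ⋯ (a+n-1)`. -/
def rf (a : ℂ) (n : ℕ) : ℂ := (ascPochhammer ℂ n).eval a

/-- `y` is the sum of the series `a 0 + a 1 + a 2 + ⋯` (limit of the partial sums). -/
def SeriesTo (a : ℕ → ℂ) (y : ℂ) : Prop :=
  Tendsto (fun N => ∑ n ∈ Finset.range N, a n) atTop (𝓝 y)

/-! ### Classical functions -/

/-- Confluent hypergeometric polynomial of the first kind `F_b(γ; z)`. -/
def polyF (b : ℕ) (γ z : ℂ) : ℂ :=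
  Complex.Gamma (b + γ) / Complex.Gamma γ *
    ∑ n ∈ Finset.Icc 0 b, rf (-(b : ℂ)) n / (rf γ n * (n.factorial : ℂ)) * z ^ n

/-- Confluent hypergeometric polynomial of the second kind `A_b(γ; z)`. -/
def polyA (b : ℕ) (γ z : ℂ) : ℂ :=
  Complex.Gamma (b + 2 - γ) / Complex.Gamma (2 - γ) *
    ∑ n ∈ Finset.Icc 0 b, rf (-(b : ℂ)) n / ((n.factorial : ℂ) * rf (2 - γ) n) * z ^ n

/-- Kummer function of the first kind `M(a, b, z)`. -/
def kummerM (a b z : ℂ) : ℂ := ∑' n : ℕ, rf a n / (rf b n * (n.factorial : ℂ)) * z ^ n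

/-! ### Power series solutions

`lam` is the indicial root; the `n`-th sub-power series has `n + 1` nested summations over
`i_0 ≤ i_1 ≤ ⋯ ≤ i_n`. -/

/-- Coefficient `(a)_i / ((1 + lam/2)_i (γ + lam/2)_i)` of the outermost sum. -/
def startCoeff (lam γ a : ℂ) (i : ℕ) : ℂ :=
  rf a i / (rf (1 + lam / 2) i * rf (γ + lam / 2) i)

/-- The factor
`(i + lam/2 + ω/2 + k/2) / ((i + 1/2 + lam/2 + k/2) (i - 1/2 + γ + k/2 + lam/2))`. -/
def stepWeight (lam γ ω : ℂ) (k i : ℕ) : ℂ :=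
  (i + lam / 2 + ω / 2 + k / 2) /
    ((i + 1 / 2 + lam / 2 + k / 2) * (i - 1 / 2 + γ + k / 2 + lam / 2))

/-- The factor `(a)_j (1+k/2+lam/2)_i (k/2+γ+lam/2)_i / ((a)_i (1+k/2+lam/2)_j (k/2+γ+lam/2)_j)`. -/
def stepRatio (lam γ a : ℂ) (k i j : ℕ) : ℂ :=
  (rf a j * rf (1 + k / 2 + lam / 2) i * rf (k / 2 + γ + lam / 2) i) /
    (rf a i * rf (1 + k / 2 + lam / 2) j * rf (k / 2 + γ + lam / 2) j)

/-- The `m + 1` innermost sums (those over `i_k, …, i_{k+m}`), as a function of `i = i_{k-1}`,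
for the polynomial case: `i_k` runs up to `β k`. -/
def polyTail (lam γ ω : ℂ) (β : ℕ → ℕ) (z : ℂ) : ℕ → ℕ → ℕ → ℂ
  | 0, k, i => ∑ j ∈ Finset.Icc i (β k), stepRatio lam γ (-(β k : ℂ)) k i j * z ^ j
  | m + 1, k, i => ∑ j ∈ Finset.Icc i (β k),
      stepWeight lam γ ω k j * stepRatio lam γ (-(β k : ℂ)) k i j *
        polyTail lam γ ω β z m (k + 1) j

/-- The coefficient of `c_0 x^lam ε̃^n` in the power series of the GCH polynomial. -/
def polyTerm (lam γ ω : ℂ) (β : ℕ → ℕ) (z : ℂ) : ℕ → ℂ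
  | 0 => ∑ i ∈ Finset.Icc 0 (β 0), startCoeff lam γ (-(β 0 : ℂ)) i * z ^ i
  | n + 1 => ∑ i ∈ Finset.Icc 0 (β 0),
      stepWeight lam γ ω 0 i * startCoeff lam γ (-(β 0 : ℂ)) i * polyTail lam γ ω β z n 1 i

/-- Summand of index `i_k = i + l` of the sum over `i_k ≥ i = i_{k-1}` in the infinite series case,
when `T` is the value of the sums further inside. Here `q = Ω / (2 μ)`. -/
def infSummand (lam γ q : ℂ) (T : ℕ → ℂ) (k i l : ℕ) : ℂ :=
  stepRatio lam γ (q + k / 2 + lam / 2) k i (i + l) * T (i + l)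

/-- Infinite series analogue of `polyTail`. -/
def infTail (lam γ ω q z : ℂ) : ℕ → ℕ → ℕ → ℂ
  | 0, k, i => ∑' l : ℕ, infSummand lam γ q (fun j => z ^ j) k i l
  | m + 1, k, i => ∑' l : ℕ, infSummand lam γ q
      (fun j => stepWeight lam γ ω k j * infTail lam γ ω q z m (k + 1) j) k i l

/-- Summand of index `i_0 = i` of the outermost sum of the `n`-th sub-power series. -/
def infStart (lam γ ω q z : ℂ) : ℕ → ℕ → ℂ
  | 0, i => startCoeff lam γ (q + lam / 2) i * z ^ i
  | n + 1, i => stepWeight lam γ ω 0 i * startCoeff lam γ (q + lam / 2) i *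
      infTail lam γ ω q z n 1 i

/-- The coefficient of `c_0 x^lam ε̃^n` in the infinite power series of the GCH function. -/
def infTerm (lam γ ω q z : ℂ) (n : ℕ) : ℂ := ∑' i : ℕ, infStart lam γ ω q z n i

/-- All the nested infinite sums converge absolutely. -/
def InfSumsConverge (lam γ ω q z : ℂ) : Prop :=
  (∀ n, Summable (infStart lam γ ω q z n)) ∧
  (∀ k i, 1 ≤ k → Summable (infSummand lam γ q (fun j => z ^ j) k i)) ∧
  (∀ m k i, 1 ≤ k → Summable (infSummand lam γ q
      (fun j => stepWeight lam γ ω k j * infTail lam γ ω q z m (k + 1) j) k i))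

/-- Terms (in powers of `ε̃`) of the GCH polynomial of the first kind `QW_β(ω, γ; ε̃; z)`:
`lam = 0` and `c_0 = Γ(β_0 + γ) / Γ(γ)`. -/
def QWpolyTerm (β : ℕ → ℕ) (ω γ εt z : ℂ) (n : ℕ) : ℂ :=
  Complex.Gamma (β 0 + γ) / Complex.Gamma γ * polyTerm 0 γ ω β z n * εt ^ n

/-- Terms of the GCH polynomial of the second kind `RW_ψ(ω, γ; ε̃; z)`: `lam = 2 (1 - γ)` and
`c_0 x^lam = z^(1-γ) Γ(ψ_0 + 2 - γ) / Γ(2 - γ)`. -/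
def RWpolyTerm (ψ : ℕ → ℕ) (ω γ εt z : ℂ) (n : ℕ) : ℂ :=
  z ^ (1 - γ) * (Complex.Gamma (ψ 0 + 2 - γ) / Complex.Gamma (2 - γ)) *
    polyTerm (2 * (1 - γ)) γ ω ψ z n * εt ^ n

/-- Terms of the first kind infinite series `QW(ω, γ; ε̃; z)`, with `q = Ω / (2 μ)`:
`lam = 0` and `c_0 = Γ(γ - q) / Γ(γ)`. -/
def QWTerm (q ω γ εt z : ℂ) (n : ℕ) : ℂ :=
  Complex.Gamma (γ - q) / Complex.Gamma γ * infTerm 0 γ ω q z n * εt ^ n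

/-- Terms of the second kind infinite series `RW(ω, γ; ε̃; z)`, with `q = Ω / (2 μ)`:
`lam = 2 (1 - γ)` and `c_0 x^lam = z^(1-γ) Γ(1 - q) / Γ(2 - γ)`. -/
def RWTerm (q ω γ εt z : ℂ) (n : ℕ) : ℂ :=
  z ^ (1 - γ) * (Complex.Gamma (1 - q) / Complex.Gamma (2 - γ)) *
    infTerm (2 * (1 - γ)) γ ω q z n * εt ^ n

/-! ### Nested integral operators -/

/-- `(1/(2πi)) ∮ exp(-v X/(1-v)) / (v^(b+1) (1-v)) f(v) dv` over the counterclockwise circle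
`|v| = r`, which for `0 < r < 1` encloses `0` but not `1`. -/
def polyContour (r : ℝ) (b : ℕ) (X : ℂ) (f : ℂ → ℂ) : ℂ :=
  (2 * Real.pi * Complex.I)⁻¹ *
    ∮ v in C(0, r), Complex.exp (-(v / (1 - v)) * X) / (v ^ (b + 1) * (1 - v)) * f v

/-- `(1/(2πi)) ∮ exp(-v X/(1-v)) / (v^(-a+1) (1-v)) f(v) dv` with the principal branch of the power,
over the clockwise circle `|v - 1| = r`, which for `0 < r < 1` stays off the branch cut `(-∞, 0]`.
(If `-a` is a natural number, this is `polyContour` for the polynomial `f` of degree `≤ -a`: the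
contour separates `0` from `1`.) -/
def infContour (r : ℝ) (a : ℂ) (X : ℂ) (f : ℂ → ℂ) : ℂ :=
  (2 * Real.pi * Complex.I)⁻¹ *
    -(∮ v in C(1, r), Complex.exp (-(v / (1 - v)) * X) / (v ^ (-a + 1) * (1 - v)) * f v)

/-- Integrand of the `u_m`-integral; `C` is the contour integral in `v_m`, and `g` is a function of
`w_{m,n} = w t_m u_m v_m`, where `w = w_{m+1,n}`. -/
def uIntegrand (lam γ : ℂ) (m : ℕ) (C : ℂ → (ℂ → ℂ) → ℂ) (g : ℂ → ℂ) (w : ℂ) (t u : ℝ) : ℂ :=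
  (u : ℂ) ^ (γ + m / 2 - 2 + lam / 2) * C (w * (1 - t) * (1 - u)) (fun v => g (w * t * u * v))

/-- Integrand of the `t_m`-integral. -/
def tIntegrand (lam γ : ℂ) (m : ℕ) (C : ℂ → (ℂ → ℂ) → ℂ) (g : ℂ → ℂ) (w : ℂ) (t : ℝ) : ℂ :=
  (t : ℂ) ^ ((m : ℂ) / 2 - 1 + lam / 2) * ∫ u in (0 : ℝ)..1, uIntegrand lam γ m C g w t u

/-- The first order operator `w ∂_w + (m - 1 + ω + lam)/2`. -/
def eulerOp (lam ω : ℂ) (m : ℕ) (f : ℂ → ℂ) (w : ℂ) : ℂ :=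
  w * deriv f w + ((m : ℂ) - 1 + ω + lam) / 2 * f w

/-- `nested … n`, evaluated at `z`, is the `n`-fold integral operator applied to `f`: the operators
of index `n, n-1, …, 1` from the outside to the inside, the one of index `m` being
`∫ dt_m t_m^(…) ∫ du_m u_m^(…) (1/(2πi)) ∮ dv_m (…) (w_{m,n} ∂ + (m - 1 + ω + lam)/2)`,
and `f` evaluated at `w_{1,n} = z ∏ t_l u_l v_l`. -/
def nested (lam γ ω : ℂ) (C : ℕ → ℂ → (ℂ → ℂ) → ℂ) (f : ℂ → ℂ) : ℕ → ℂ → ℂ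
  | 0 => f
  | m + 1 => fun w => ∫ t in (0 : ℝ)..1,
      tIntegrand lam γ (m + 1) (C (m + 1)) (eulerOp lam ω (m + 1) (nested lam γ ω C f m)) w t

/-- All derivatives and integrals in `nested` exist. -/
def IntegralsConverge (lam γ ω : ℂ) (C : ℕ → ℂ → (ℂ → ℂ) → ℂ) (f : ℂ → ℂ) : Prop :=
  ∀ m, Differentiable ℂ (nested lam γ ω C f m) ∧
    ∀ w : ℂ,
      (∀ t ∈ Set.Icc (0 : ℝ) 1, IntervalIntegrable
        (uIntegrand lam γ (m + 1) (C (m + 1)) (eulerOp lam ω (m + 1) (nested lam γ ω C f m)) w t)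
        volume 0 1) ∧
      IntervalIntegrable
        (tIntegrand lam γ (m + 1) (C (m + 1)) (eulerOp lam ω (m + 1) (nested lam γ ω C f m)) w)
        volume 0 1

/-- Contour integrals of the polynomial case: index `m` uses `β_m` and the radius `r_m`. -/
def polyContours (r : ℕ → ℝ) (β : ℕ → ℕ) (m : ℕ) : ℂ → (ℂ → ℂ) → ℂ := polyContour (r m) (β m)

/-- Contour integrals of the infinite series case: index `m` uses the power
`v_m^(-(q + m/2 + lam/2) + 1)`, with `q = Ω / (2 μ)`, and the radius `r_m`. -/
def infContours (r : ℕ → ℝ) (lam q : ℂ) (m : ℕ) : ℂ → (ℂ → ℂ) → ℂ :=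
  infContour (r m) (q + m / 2 + lam / 2)

end GCH

end

namespace GCH

/-! Both sides are series in `ε̃` whose `n`-th coefficients are entire functions of `z`, and these
are compared through their Taylor coefficients. Reversing the order of the nested sums, so that the
innermost index becomes the outermost, writes the `n`-th sub-power series as `∑ j, c_n(j) z^j`. Here
`c_n` is `coeff`, with the recursion `c_{m+1}(j) = ∑_{i ≤ j} c_m(i) b_m(i) ρ_{m+1}(i,j)`
(`Indicial.tsum_coeff_mul_tail`).

The integral operator of index `m + 1` realises exactly this recursion (`Indicial.nested_succ`). The
Euler operator multiplies `c_m(i)` by the numerator of `b_m(i)`. Expanding the exponential in powers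
of `X = w(1-t)(1-u)`, the contour integral turns `v^i` into `∑ k, (a+i)_k X^k / (k!)^2` with `a =
a_{m+1}` (`ContourSpec`). The two Beta integrals in `t` and `u` each give `k!` over a rising
factorial of length `k + 1`. The first factors of these two are the denominators of `b_m(i)`, the
remaining ones belong to `ρ_{m+1}(i,i+k)`, and the factorials cancel.

This needs `(a_{m+1})_i ≠ 0` wherever `c_m(i) ≠ 0`. For polynomials that is the monotonicity of `β`,
as `c_m` vanishes beyond `β_m`; for infinite series it is the condition that no `a_k` with `k ≥ 1`
is a non-positive integer.

The analysis rests on `Indicial.norm_coeff_le`: the coefficients decay like `1/j!`, which makes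
every function entire and every interchange legitimate, and the weights contribute `1/m!`, which
gives absolute convergence in `n` when the parameters satisfy `‖a_k‖ ≤ A + k/2` uniformly. The
conditions on `Re γ` are integrability at `0` of the weights in `t` and `u`. -/

theorem rf_eq_prod (a : ℂ) (n : ℕ) : rf a n = ∏ x ∈ Finset.range n, (a + x) := by
  induction n with
  | zero => simp [rf]
  | succ n ih =>
    rw [Finset.prod_range_succ, ← ih, rf, ascPochhammer_succ_eval]
    rfl

@[simp] theorem rf_zero (a : ℂ) : rf a 0 = 1 := by simp [rf]

theorem rf_succ (a : ℂ) (n : ℕ) : rf a (n + 1) = rf a n * (a + n) := by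
  simp [rf_eq_prod, Finset.prod_range_succ]

theorem rf_add (a : ℂ) (i l : ℕ) : rf a (i + l) = rf a i * rf (a + i) l := by
  simp [rf_eq_prod, Finset.prod_range_add, add_assoc]

theorem rf_succ' (a : ℂ) (n : ℕ) : rf a (n + 1) = a * rf (a + 1) n := by
  rw [add_comm n 1, rf_add]
  simp [rf_eq_prod]

theorem rf_one (n : ℕ) : rf 1 n = (n.factorial : ℂ) := by
  rw [rf, ascPochhammer_eval_one]

theorem rf_ne_zero_iff {a : ℂ} {n : ℕ} : rf a n ≠ 0 ↔ ∀ x < n, a + (x : ℂ) ≠ 0 := by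
  simp [rf_eq_prod, Finset.prod_ne_zero_iff]

theorem rf_neg_natCast_ne_zero_iff {b i : ℕ} : rf (-(b : ℂ)) i ≠ 0 ↔ i ≤ b := by
  rw [rf_ne_zero_iff]
  constructor
  · intro h
    by_contra! hb
    exact h b hb (by simp)
  · intro h x hx h0
    have : (x : ℂ) = b := by linear_combination h0
    have : x = b := by exact_mod_cast this
    omega

theorem rf_neg_natCast_eq_zero {b i : ℕ} (h : b < i) : rf (-(b : ℂ)) i = 0 := by
  by_contra h'
  exact absurd (rf_neg_natCast_ne_zero_iff.1 h') (by omega)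

/-- Factorwise comparison of two rising factorials. -/
theorem norm_rf_le_of_forall {a b : ℂ} {B : ℝ} (n : ℕ)
    (h : ∀ x : ℕ, ‖a + x‖ ≤ B * ‖b + x‖) : ‖rf a n‖ ≤ B ^ n * ‖rf b n‖ := by
  simp only [rf_eq_prod, norm_prod]
  calc ∏ x ∈ Finset.range n, ‖a + x‖ ≤ ∏ x ∈ Finset.range n, (B * ‖b + x‖) :=
        Finset.prod_le_prod (fun _ _ => norm_nonneg _) (fun x _ => h x)
    _ = _ := by rw [Finset.prod_mul_distrib]; simp

/-! ### Double series dominated by a product of exponential series. -/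

theorem summable_exp_prod (X Y : ℝ) :
    Summable fun x : ℕ × ℕ => X ^ x.1 / (x.1.factorial : ℝ) * (Y ^ x.2 / (x.2.factorial : ℝ)) := by
  exact summable_mul_of_summable_norm (f := fun i : ℕ => X ^ i / (i.factorial : ℝ))
    (g := fun i : ℕ => Y ^ i / (i.factorial : ℝ))
    (Real.summable_pow_div_factorial X).norm (Real.summable_pow_div_factorial Y).norm

theorem summable_of_norm_le_exp_prod {F : ℕ × ℕ → ℂ} (K X Y : ℝ)
    (h : ∀ i l, ‖F (i, l)‖ ≤
      K * (X ^ i / (i.factorial : ℝ) * (Y ^ l / (l.factorial : ℝ)))) : Summable F :=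
  Summable.of_norm_bounded ((summable_exp_prod X Y).mul_left K) fun x => h x.1 x.2

theorem hasSum_antidiagonal {F : ℕ × ℕ → ℂ} (hF : Summable F) :
    HasSum (fun n => ∑ i ∈ Finset.range (n + 1), F (i, n - i)) (∑' x, F x) := by
  have h := (Finset.HasAntidiagonal.sigmaAntidiagonalEquivProd (A := ℕ)).hasSum_iff.2 hF.hasSum
  have h2 := h.sigma (fun n => (hasSum_fintype _))
  convert h2 using 2 with n
  rw [← Finset.Nat.sum_antidiagonal_eq_sum_range_succ_mk, ← Finset.sum_coe_sort]
  rfl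

/-- Exchange of the order of a double series with triangular index set. -/
theorem tsum_tsum_mul_eq_tsum_sum {c : ℕ → ℂ} {R : ℕ → ℕ → ℂ} {T : ℕ → ℂ} {K X Y : ℝ}
    (h : ∀ i l, ‖c i * (R i (i + l) * T (i + l))‖ ≤
      K * (X ^ i / (i.factorial : ℝ) * (Y ^ l / (l.factorial : ℝ)))) :
    ∑' i, c i * ∑' l, R i (i + l) * T (i + l) =
      ∑' j, (∑ i ∈ Finset.range (j + 1), c i * R i j) * T j := by
  have hF := summable_of_norm_le_exp_prod (F := fun x => c x.1 * (R x.1 (x.1 + x.2) * T (x.1 + x.2)))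
    K X Y h
  have h2 := (hasSum_antidiagonal hF).tsum_eq
  rw [hF.tsum_prod] at h2
  simp only [tsum_mul_left] at h2
  rw [← h2]
  congr 1
  ext j
  rw [Finset.sum_mul]
  refine Finset.sum_congr rfl fun i hi => ?_
  have : i + (j - i) = j := by have := Finset.mem_range.1 hi; omega
  rw [this, mul_assoc]

/-! ### Entire functions of exponential type -/

/-- Taylor coefficients of an entire function of exponential type. -/
def ExpBound (c : ℕ → ℂ) : Prop :=
  ∃ K X : ℝ, 0 ≤ K ∧ 0 ≤ X ∧ ∀ i, ‖c i‖ ≤ K * (X ^ i / (i.factorial : ℝ))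

theorem ExpBound.const_mul {c : ℕ → ℂ} (h : ExpBound c) (a : ℂ) : ExpBound fun i => a * c i := by
  obtain ⟨K, X, hK, hX, h⟩ := h
  refine ⟨‖a‖ * K, X, by positivity, hX, fun i => ?_⟩
  rw [norm_mul, mul_assoc]
  exact mul_le_mul_of_nonneg_left (h i) (norm_nonneg _)

theorem ExpBound.linear_mul {c : ℕ → ℂ} (h : ExpBound c) (a : ℂ) :
    ExpBound fun i => (i + a) * c i := by
  obtain ⟨K, X, hK, hX, h⟩ := h
  -- The linear factor is at most `(1 + ‖a‖) 2^i`, and `2^i` is absorbed by doubling `X`.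
  refine ⟨(1 + ‖a‖) * K, 2 * X, by positivity, by positivity, fun i => ?_⟩
  have h1 : ‖(i + a : ℂ)‖ ≤ (1 + ‖a‖) * 2 ^ i := by
    have h2 : (i : ℝ) ≤ 2 ^ i := by exact_mod_cast (Nat.lt_two_pow_self).le
    have h3 : (1 : ℝ) ≤ 2 ^ i := one_le_pow₀ (by norm_num)
    calc ‖(i + a : ℂ)‖ ≤ i + ‖a‖ := by simpa using norm_add_le (i : ℂ) a
      _ ≤ _ := by nlinarith [norm_nonneg a]
  calc ‖(i + a) * c i‖ ≤ ((1 + ‖a‖) * 2 ^ i) * (K * (X ^ i / (i.factorial : ℝ))) := by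
        rw [norm_mul]; exact mul_le_mul h1 (h i) (norm_nonneg _) (by positivity)
    _ = _ := by rw [mul_pow]; ring

theorem ExpBound.summable_norm {c : ℕ → ℂ} (h : ExpBound c) (R : ℝ) :
    Summable fun i => ‖c i‖ * R ^ i := by
  obtain ⟨K, X, hK, hX, h⟩ := h
  refine Summable.of_norm_bounded ((Real.summable_pow_div_factorial (X * |R|)).mul_left K)
    fun i => ?_
  rw [norm_mul, norm_norm, norm_pow, Real.norm_eq_abs]
  calc ‖c i‖ * |R| ^ i ≤ K * (X ^ i / (i.factorial : ℝ)) * |R| ^ i := by gcongr; exact h i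
    _ = _ := by rw [mul_pow]; ring

theorem ExpBound.summable {c : ℕ → ℂ} (h : ExpBound c) (w : ℂ) :
    Summable fun i => c i * w ^ i :=
  Summable.of_norm (by simpa using h.summable_norm ‖w‖)

theorem ExpBound.hasDerivAt {c : ℕ → ℂ} (h : ExpBound c) (w : ℂ) :
    DifferentiableAt ℂ (fun w => ∑' i, c i * w ^ i) w ∧
      HasSum (fun i : ℕ => c i * (i * w ^ (i - 1))) (deriv (fun w => ∑' i, c i * w ^ i) w) := by
  have hd : ∀ i, DifferentiableOn ℂ (fun w : ℂ => c i * w ^ i) (Metric.ball 0 (‖w‖ + 1)) :=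
    fun i => by fun_prop
  have hb : ∀ i, ∀ v ∈ Metric.ball (0 : ℂ) (‖w‖ + 1), ‖c i * v ^ i‖ ≤ ‖c i‖ * (‖w‖ + 1) ^ i := by
    intro i v hv
    rw [norm_mul, norm_pow]
    have : ‖v‖ ≤ ‖w‖ + 1 := by simpa using (mem_ball_zero_iff.1 hv).le
    gcongr
  have hw : w ∈ Metric.ball (0 : ℂ) (‖w‖ + 1) := by simp
  constructor
  · exact (Complex.differentiableOn_tsum_of_summable_norm (h.summable_norm _) hd
      Metric.isOpen_ball hb).differentiableAt (Metric.isOpen_ball.mem_nhds hw)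
  · have := Complex.hasSum_deriv_of_summable_norm (h.summable_norm _) hd
      Metric.isOpen_ball hb hw
    have e : (fun i : ℕ => c i * (i * w ^ (i - 1))) = fun i => deriv (fun w => c i * w ^ i) w := by
      funext i
      simp
    rw [e]
    exact this

theorem ExpBound.differentiable {c : ℕ → ℂ} (h : ExpBound c) :
    Differentiable ℂ (fun w => ∑' i, c i * w ^ i) := fun w => (h.hasDerivAt w).1

theorem eulerOp_tsum {c : ℕ → ℂ} (h : ExpBound c) (lam ω : ℂ) (m : ℕ) (w : ℂ) :
    eulerOp lam ω m (fun w => ∑' i, c i * w ^ i) w =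
      ∑' i : ℕ, ((i + ((m : ℂ) - 1 + ω + lam) / 2) * c i) * w ^ i := by
  rw [eulerOp, ← (h.hasDerivAt w).2.tsum_eq, ← tsum_mul_left, ← tsum_mul_left,
    ← Summable.tsum_add]
  · congr 1
    ext i
    -- The case `i = 0` is separate because `i - 1` truncates there; the factor `i` kills the term.
    rcases i with _ | i
    · simp
    · simp only [Nat.add_sub_cancel]; ring
  · exact (h.hasDerivAt w).2.summable.mul_left _
  · exact (h.summable w).mul_left _

/-- The exponents of the two indicial roots `lam = 0`, `lam = 2 (1 - γ)` for which the weights of the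
integral operators are integrable. -/
structure Indicial (lam γ : ℂ) : Prop where
  left : 1 / 2 < (1 + lam / 2).re
  right : 1 / 2 < (γ + lam / 2).re
  root : lam = 0 ∨ γ + lam / 2 = 1

/-- Taylor coefficients of the `m`-th sub-power series, for the numerator parameters `a`. -/
noncomputable def coeff (lam γ ω : ℂ) (a : ℕ → ℂ) : ℕ → ℕ → ℂ
  | 0, j => startCoeff lam γ (a 0) j
  | m + 1, j => ∑ i ∈ Finset.range (j + 1),
      coeff lam γ ω a m i * stepWeight lam γ ω m i * stepRatio lam γ (a (m + 1)) (m + 1) i j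

/-- Common form of `polyTail` and `infTail`. -/
noncomputable def tail (lam γ ω : ℂ) (a : ℕ → ℂ) (z : ℂ) : ℕ → ℕ → ℕ → ℂ
  | 0, k, i => ∑' l : ℕ, stepRatio lam γ (a k) k i (i + l) * z ^ (i + l)
  | m + 1, k, i => ∑' l : ℕ, stepRatio lam γ (a k) k i (i + l) *
      (stepWeight lam γ ω k (i + l) * tail lam γ ω a z m (k + 1) (i + l))

/-! ### Bounds for the ratios, weights and coefficients. -/

variable {lam γ : ℂ}

theorem Indicial.le_norm_left (h : Indicial lam γ) (k i x : ℕ) :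
    1 / 2 + (k : ℝ) / 2 + i + x ≤ ‖(1 + k / 2 + lam / 2 + i + x : ℂ)‖ := by
  refine le_trans ?_ (Complex.re_le_norm _)
  have := h.left
  simp only [Complex.add_re, Complex.natCast_re, Complex.div_ofNat_re, Complex.one_re] at this ⊢
  linarith

theorem Indicial.le_norm_right (h : Indicial lam γ) (k i x : ℕ) :
    1 / 2 + (k : ℝ) / 2 + i + x ≤ ‖(k / 2 + γ + lam / 2 + i + x : ℂ)‖ := by
  refine le_trans ?_ (Complex.re_le_norm _)
  have := h.right
  simp only [Complex.add_re, Complex.natCast_re, Complex.div_ofNat_re] at this ⊢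
  linarith

theorem Indicial.rf_left_ne_zero (h : Indicial lam γ) (k i l : ℕ) :
    rf (1 + k / 2 + lam / 2 + i) l ≠ 0 := by
  rw [rf_ne_zero_iff]
  intro x _
  rw [← norm_pos_iff]
  exact lt_of_lt_of_le (by positivity) (h.le_norm_left k i x)

theorem Indicial.rf_right_ne_zero (h : Indicial lam γ) (k i l : ℕ) :
    rf (k / 2 + γ + lam / 2 + i) l ≠ 0 := by
  rw [rf_ne_zero_iff]
  intro x _
  rw [← norm_pos_iff]
  exact lt_of_lt_of_le (by positivity) (h.le_norm_right k i x)

theorem stepRatio_eq_zero_of_left {a : ℂ} {k i j : ℕ} (h : rf a i = 0) :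
    stepRatio lam γ a k i j = 0 := by simp [stepRatio, h]

theorem stepRatio_eq_zero_of_right {a : ℂ} {k i j : ℕ} (h : rf a j = 0) :
    stepRatio lam γ a k i j = 0 := by simp [stepRatio, h]

/-- The factors of index below `i` cancel by `(x)_{i+l} = (x)_i (x+i)_l`. `Indicial` makes the
denominators nonzero; only `(a)_i` needs a separate hypothesis. -/
theorem Indicial.stepRatio_add (h : Indicial lam γ) {a : ℂ} {k i : ℕ} (l : ℕ) (ha : rf a i ≠ 0) :
    stepRatio lam γ a k i (i + l) =
      rf (a + i) l / (rf (1 + k / 2 + lam / 2 + i) l * rf (k / 2 + γ + lam / 2 + i) l) := by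
  have h1 := h.rf_left_ne_zero k 0 i
  have h2 := h.rf_right_ne_zero k 0 i
  have h3 := h.rf_left_ne_zero k i l
  have h4 := h.rf_right_ne_zero k i l
  simp only [Nat.cast_zero, add_zero] at h1 h2
  rw [stepRatio, rf_add, rf_add, rf_add]
  generalize rf (1 + k / 2 + lam / 2) i = P at *
  generalize rf (k / 2 + γ + lam / 2) i = Q at *
  generalize rf (1 + k / 2 + lam / 2 + i) l = P' at *
  generalize rf (k / 2 + γ + lam / 2 + i) l = Q' at *
  field_simp

/-- The constant `1 + 2A` is chosen so that `2A · 1/2` pays for `A`; the `1/2` is the margin in the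
lower bounds supplied by `Indicial`. -/
theorem norm_add_le_of_norm_le {a b : ℂ} {A y t : ℝ} (hA : 0 ≤ A) (hy : 0 ≤ y) (ht : 0 ≤ t)
    (ha : ‖a‖ ≤ A + y) (hb : ‖b‖ ≤ t) : ‖a + b‖ ≤ (1 + 2 * A) * (1 / 2 + y + t) := by
  refine (norm_add_le _ _).trans ?_
  nlinarith [mul_nonneg hA hy, mul_nonneg hA ht]

theorem norm_rf_one_add (i l : ℕ) :
    ‖rf (1 + i) l‖ = ((i + l).factorial : ℝ) / (i.factorial : ℝ) := by
  have h := congrArg norm (rf_add 1 i l)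
  rw [norm_mul, rf_one, rf_one] at h
  simp only [Complex.norm_natCast] at h
  rw [h]
  field_simp

/-- The numerator is compared factor by factor with one denominator, at the cost of `(1 + 2A)^l`.
The other denominator dominates `(1+i)_l = (i+l)!/i!`, because `1/2 + k/2 ≥ 1` for `k ≥ 1`. -/
theorem Indicial.norm_stepRatio_le (h : Indicial lam γ) {a : ℂ} {A : ℝ} (hA : 0 ≤ A) {k : ℕ}
    (hk : 1 ≤ k) (ha : ‖a‖ ≤ A + k / 2) (i l : ℕ) :
    ‖stepRatio lam γ a k i (i + l)‖ ≤
      (1 + 2 * A) ^ l * ((i.factorial : ℝ) / ((i + l).factorial : ℝ)) := by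
  -- If `(a)_i = 0`, the ratio is a division by zero, with value `0`.
  by_cases h0 : rf a i = 0
  · rw [stepRatio_eq_zero_of_left h0, norm_zero]; positivity
  rw [h.stepRatio_add l h0, norm_div, norm_mul]
  have hk' : (1 : ℝ) ≤ k := by exact_mod_cast hk
  have e1 : ‖rf (a + i) l‖ ≤ (1 + 2 * A) ^ l * ‖rf (k / 2 + γ + lam / 2 + i) l‖ := by
    refine norm_rf_le_of_forall l fun x => ?_
    refine le_trans ?_ (mul_le_mul_of_nonneg_left (h.le_norm_right k i x) (by positivity))
    rw [add_assoc a]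
    have := norm_add_le_of_norm_le (b := (i : ℂ) + x) (t := i + x) hA (by positivity)
      (by positivity) ha (by simpa using norm_add_le (i : ℂ) x)
    linarith
  have e2 : ‖rf (1 + i) l‖ ≤ 1 ^ l * ‖rf (1 + k / 2 + lam / 2 + i) l‖ := by
    refine norm_rf_le_of_forall l fun x => ?_
    rw [one_mul]
    refine le_trans ?_ (h.le_norm_left k i x)
    have : ‖(1 + i + x : ℂ)‖ = 1 + i + x := by
      have : (1 + i + x : ℂ) = ((1 + i + x : ℕ) : ℂ) := by push_cast; ring
      rw [this, Complex.norm_natCast]; push_cast; ring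
    rw [this]; linarith
  rw [one_pow, one_mul, norm_rf_one_add] at e2
  have p1 : 0 < ‖rf (k / 2 + γ + lam / 2 + i) l‖ := norm_pos_iff.2 (h.rf_right_ne_zero k i l)
  have p2 : 0 < ((i + l).factorial : ℝ) / (i.factorial : ℝ) := by positivity
  have p3 := p2.trans_le e2
  rw [div_le_iff₀ (by positivity)]
  calc ‖rf (a + i) l‖ ≤ (1 + 2 * A) ^ l * ‖rf (k / 2 + γ + lam / 2 + i) l‖ := e1
    _ = (1 + 2 * A) ^ l * ((i.factorial : ℝ) / ((i + l).factorial : ℝ)) *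
        (((i + l).factorial : ℝ) / (i.factorial : ℝ) * ‖rf (k / 2 + γ + lam / 2 + i) l‖) := by
        field_simp
    _ ≤ _ := by gcongr

theorem factorial_div_factorial_add_le (i l : ℕ) :
    (i.factorial : ℝ) / ((i + l).factorial : ℝ) ≤ 1 / (l.factorial : ℝ) := by
  rw [div_le_div_iff₀ (by positivity) (by positivity), one_mul]
  exact_mod_cast Nat.le_of_dvd (Nat.factorial_pos _) (Nat.factorial_mul_factorial_dvd_factorial_add i l)

theorem Indicial.norm_stepRatio_le' (h : Indicial lam γ) {a : ℂ} {A : ℝ} (hA : 0 ≤ A) {k : ℕ}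
    (hk : 1 ≤ k) (ha : ‖a‖ ≤ A + k / 2) (i l : ℕ) :
    ‖stepRatio lam γ a k i (i + l)‖ ≤ (1 + 2 * A) ^ l / (l.factorial : ℝ) := by
  refine (h.norm_stepRatio_le hA hk ha i l).trans ?_
  rw [div_eq_mul_one_div ((1 + 2 * A) ^ l)]
  exact mul_le_mul_of_nonneg_left (factorial_div_factorial_add_le i l) (by positivity)

/-- For `k = 0` the general lower bound starts at `1/2` and does not yield a factorial. The indicial
root does: it makes one of the two denominators equal to `(1)_i = i!`. -/
theorem Indicial.norm_startCoeff_le (h : Indicial lam γ) {a : ℂ} {A : ℝ} (hA : 0 ≤ A)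
    (ha : ‖a‖ ≤ A) (i : ℕ) :
    ‖startCoeff lam γ a i‖ ≤ (1 + 2 * A) ^ i / (i.factorial : ℝ) := by
  have key : ∀ y : ℂ, (∀ x : ℕ, 1 / 2 + (x : ℝ) ≤ ‖y + x‖) → rf y i ≠ 0 →
      ‖rf a i‖ / (i.factorial * ‖rf y i‖) ≤ (1 + 2 * A) ^ i / (i.factorial : ℝ) := by
    intro y hy h0
    have e1 : ‖rf a i‖ ≤ (1 + 2 * A) ^ i * ‖rf y i‖ := by
      refine norm_rf_le_of_forall i fun x => ?_
      refine le_trans ?_ (mul_le_mul_of_nonneg_left (hy x) (by positivity))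
      have := norm_add_le_of_norm_le (a := a) (b := (x : ℂ)) (y := 0) (t := x) hA le_rfl
        (by positivity) (by simpa using ha) (by simp)
      linarith
    have p1 : 0 < ‖rf y i‖ := norm_pos_iff.2 h0
    rw [div_le_div_iff₀ (by positivity) (by positivity)]
    calc ‖rf a i‖ * (i.factorial : ℝ) ≤ ((1 + 2 * A) ^ i * ‖rf y i‖) * (i.factorial : ℝ) := by gcongr
      _ = _ := by ring
  rw [startCoeff, norm_div, norm_mul]
  rcases h.root with h0 | h0
  · have e : (1 + lam / 2) = 1 := by simp [h0]
    rw [e, rf_one, Complex.norm_natCast]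
    refine key _ (fun x => ?_) ?_
    · simpa using h.le_norm_right 0 0 x
    · simpa using h.rf_right_ne_zero 0 0 i
  · rw [h0, rf_one, Complex.norm_natCast, mul_comm ‖_‖]
    refine key _ (fun x => ?_) ?_
    · simpa using h.le_norm_left 0 0 x
    · simpa using h.rf_left_ne_zero 0 0 i

/-- The numerator is `O(1 + k + i)` and each denominator is at least a multiple of `1 + k + i`. The
decay in `k`, uniform in `i`, later produces the `1/m!`. -/
theorem Indicial.norm_stepWeight_le (h : Indicial lam γ) (ω : ℂ) :
    ∃ D : ℝ, 0 ≤ D ∧ ∀ k i : ℕ, ‖stepWeight lam γ ω k i‖ ≤ D / (1 + k) := by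
  -- Each denominator has real part at least `δ + k/2 + i`; with `δ ≤ 1/2` this is at least `δ (1 +
  -- k + i)`.
  obtain ⟨δ, hδ, h1, h2, h3⟩ : ∃ δ : ℝ, 0 < δ ∧ δ ≤ (1 + lam / 2).re - 1 / 2 ∧
      δ ≤ (γ + lam / 2).re - 1 / 2 ∧ δ ≤ 1 / 2 :=
    ⟨min (min ((1 + lam / 2).re - 1 / 2) ((γ + lam / 2).re - 1 / 2)) (1 / 2),
      lt_min (lt_min (by linarith [h.left]) (by linarith [h.right])) (by norm_num),
      (min_le_left _ _).trans (min_le_left _ _), (min_le_left _ _).trans (min_le_right _ _),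
      min_le_right _ _⟩
  refine ⟨(1 + ‖lam / 2 + ω / 2‖) / (δ * δ), by positivity, fun k i => ?_⟩
  have hk : (0 : ℝ) ≤ k := k.cast_nonneg
  have hi : (0 : ℝ) ≤ i := i.cast_nonneg
  have l1 : δ * (1 + k + i) ≤ ‖(i + 1 / 2 + lam / 2 + k / 2 : ℂ)‖ := by
    refine le_trans ?_ (Complex.re_le_norm _)
    simp only [Complex.add_re, Complex.natCast_re, Complex.div_ofNat_re, Complex.one_re] at h1 ⊢
    nlinarith
  have l2 : δ * (1 + k + i) ≤ ‖(i - 1 / 2 + γ + k / 2 + lam / 2 : ℂ)‖ := by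
    refine le_trans ?_ (Complex.re_le_norm _)
    simp only [Complex.add_re, Complex.sub_re, Complex.natCast_re, Complex.div_ofNat_re,
      Complex.one_re] at h2 ⊢
    nlinarith
  have l3 : ‖(i + lam / 2 + ω / 2 + k / 2 : ℂ)‖ ≤ (1 + ‖lam / 2 + ω / 2‖) * (1 + k + i) := by
    have : (i + lam / 2 + ω / 2 + k / 2 : ℂ) = (i + k / 2) + (lam / 2 + ω / 2) := by ring
    rw [this]
    have e : ‖(i + k / 2 : ℂ)‖ ≤ i + k / 2 := by simpa using norm_add_le (i : ℂ) (k / 2)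
    refine (norm_add_le _ _).trans ?_
    nlinarith [norm_nonneg (lam / 2 + ω / 2), mul_nonneg (norm_nonneg (lam / 2 + ω / 2)) hk,
      mul_nonneg (norm_nonneg (lam / 2 + ω / 2)) hi]
  rw [stepWeight, norm_div, norm_mul]
  calc _ ≤ (1 + ‖lam / 2 + ω / 2‖) * (1 + k + i) / ((δ * (1 + k + i)) * (δ * (1 + k + i))) := by
        gcongr
    _ = (1 + ‖lam / 2 + ω / 2‖) / (δ * δ) / (1 + k + i) := by field_simp
    _ ≤ _ := div_le_div_of_nonneg_left (by positivity) (by positivity) (by linarith)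

theorem sum_range_two_pow_le (j m : ℕ) :
    ∑ i ∈ Finset.range (j + 1), (2 : ℝ) ^ (i + m) ≤ 2 ^ (j + (m + 1)) := by
  induction j with
  | zero => simp [pow_succ]
  | succ j ih =>
    rw [Finset.sum_range_succ]
    calc _ ≤ (2 : ℝ) ^ (j + (m + 1)) + 2 ^ (j + 1 + m) := by gcongr
      _ = _ := by ring

/-- In the recursion the bound `(1+2A)^i / i!` times that of `stepRatio` telescopes to `(1+2A)^j /
j!`, independent of `i`. The weight turns `D^m/m!` into `D^(m+1)/(m+1)!`, and the factor `2^(j+m)`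
is there to be reproduced by the geometric sum over `i ≤ j`. -/
theorem Indicial.norm_coeff_le (h : Indicial lam γ) {ω : ℂ} {a : ℕ → ℂ} {A D : ℝ} (hA : 0 ≤ A)
    (hD : 0 ≤ D) (hw : ∀ k i : ℕ, ‖stepWeight lam γ ω k i‖ ≤ D / (1 + k)) (m : ℕ)
    (ha : ∀ k ≤ m, ‖a k‖ ≤ A + k / 2) (j : ℕ) :
    ‖coeff lam γ ω a m j‖ ≤
      D ^ m / (m.factorial : ℝ) * 2 ^ (j + m) * ((1 + 2 * A) ^ j / (j.factorial : ℝ)) := by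
  induction m generalizing j with
  | zero =>
    refine (h.norm_startCoeff_le hA (by simpa using ha 0 le_rfl) j).trans ?_
    have : (1 : ℝ) ≤ 2 ^ j := one_le_pow₀ (by norm_num)
    simp only [pow_zero, Nat.factorial_zero, Nat.cast_one, div_one, one_mul, add_zero]
    exact le_mul_of_one_le_left (by positivity) this
  | succ m ih =>
    rw [coeff]
    calc _ ≤ ∑ i ∈ Finset.range (j + 1), D ^ (m + 1) / ((m + 1).factorial : ℝ) *
          ((1 + 2 * A) ^ j / (j.factorial : ℝ)) * 2 ^ (i + m) := by
          refine norm_sum_le_of_le _ fun i hi => ?_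
          have hij : i ≤ j := by have := Finset.mem_range.1 hi; omega
          obtain ⟨l, rfl⟩ := Nat.exists_eq_add_of_le hij
          rw [norm_mul, norm_mul]
          have e1 := ih (fun k hk => ha k (by omega)) i
          have e3 := h.norm_stepRatio_le hA (Nat.le_add_left 1 m) (ha (m + 1) le_rfl) i l
          refine (mul_le_mul (mul_le_mul e1 (hw m i) (norm_nonneg _) (by positivity)) e3
            (norm_nonneg _) (by positivity)).trans (le_of_eq ?_)
          rw [Nat.factorial_succ m]
          push_cast
          field_simp
          ring
      _ ≤ _ := by
          rw [← Finset.mul_sum]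
          calc _ ≤ D ^ (m + 1) / ((m + 1).factorial : ℝ) *
                ((1 + 2 * A) ^ j / (j.factorial : ℝ)) * 2 ^ (j + (m + 1)) := by
                gcongr; exact sum_range_two_pow_le j m
            _ = _ := by ring

/-- For a fixed order only finitely many parameters occur, so no growth condition on `β` is needed
there; uniformity matters only for summing over `n`. -/
theorem exists_norm_le (a : ℕ → ℂ) (N : ℕ) :
    ∃ A : ℝ, 0 ≤ A ∧ ∀ k ≤ N, ‖a k‖ ≤ A + k / 2 := by
  refine ⟨∑ k ∈ Finset.range (N + 1), ‖a k‖, by positivity, fun k hk => ?_⟩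
  have := Finset.single_le_sum (f := fun k => ‖a k‖) (fun i _ => norm_nonneg _)
    (Finset.mem_range.2 (Nat.lt_succ_of_le hk))
  have hk0 : (0 : ℝ) ≤ k := k.cast_nonneg
  linarith

theorem Indicial.expBound_coeff (h : Indicial lam γ) (ω : ℂ) (a : ℕ → ℂ) (m : ℕ) :
    ExpBound (coeff lam γ ω a m) := by
  obtain ⟨A, hA, ha⟩ := exists_norm_le a m
  obtain ⟨D, hD, hw⟩ := h.norm_stepWeight_le ω
  refine ⟨D ^ m / (m.factorial : ℝ) * 2 ^ m, 2 * (1 + 2 * A), by positivity, by positivity,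
    fun j => (h.norm_coeff_le hA hD hw m ha j).trans (le_of_eq ?_)⟩
  rw [mul_pow, pow_add]
  ring

/-- Absolute convergence of the series of the sub-power series. -/
theorem Indicial.summable_tsum_coeff (h : Indicial lam γ) (ω : ℂ) {a : ℕ → ℂ} {A : ℝ}
    (ha : ∀ k, ‖a k‖ ≤ A + k / 2) (z e : ℂ) :
    Summable fun n => (∑' j, coeff lam γ ω a n j * z ^ j) * e ^ n := by
  have hA : 0 ≤ A := (norm_nonneg _).trans (by simpa using ha 0)
  obtain ⟨D, hD, hw⟩ := h.norm_stepWeight_le ω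
  set E := ∑' j : ℕ, (2 * (1 + 2 * A) * ‖z‖) ^ j / (j.factorial : ℝ)
  refine Summable.of_norm_bounded ((Real.summable_pow_div_factorial (2 * D * ‖e‖)).mul_left E)
    fun n => ?_
  have key : ‖∑' j, coeff lam γ ω a n j * z ^ j‖ ≤ D ^ n / (n.factorial : ℝ) * 2 ^ n * E := by
    refine tsum_of_norm_bounded
      ((Real.summable_pow_div_factorial (2 * (1 + 2 * A) * ‖z‖)).hasSum.mul_left _) fun j => ?_
    rw [norm_mul, norm_pow]
    calc _ ≤ _ := mul_le_mul_of_nonneg_right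
          (h.norm_coeff_le hA hD hw n (fun k _ => ha k) j) (by positivity)
      _ = _ := by rw [mul_pow, mul_pow, pow_add]; ring
  rw [norm_mul, norm_pow]
  calc _ ≤ D ^ n / (n.factorial : ℝ) * 2 ^ n * E * ‖e‖ ^ n := by gcongr
    _ = _ := by rw [mul_pow, mul_pow]; ring

/-! ### Nested tails and the interchange of the nested sums. -/

theorem Indicial.summable_stepRatio_mul (h : Indicial lam γ) {a : ℂ} {A : ℝ} (hA : 0 ≤ A) {k : ℕ}
    (hk : 1 ≤ k) (ha : ‖a‖ ≤ A + k / 2) {T : ℕ → ℂ} {K Y : ℝ} (hT : ∀ i, ‖T i‖ ≤ K * Y ^ i)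
    (i : ℕ) : (Summable fun l => stepRatio lam γ a k i (i + l) * T (i + l)) ∧
      ‖∑' l, stepRatio lam γ a k i (i + l) * T (i + l)‖ ≤
        K * Real.exp ((1 + 2 * A) * Y) * Y ^ i := by
  have hb : ∀ l, ‖stepRatio lam γ a k i (i + l) * T (i + l)‖ ≤
      K * Y ^ i * (((1 + 2 * A) * Y) ^ l / (l.factorial : ℝ)) := by
    intro l
    rw [norm_mul]
    calc _ ≤ (1 + 2 * A) ^ l / (l.factorial : ℝ) * (K * Y ^ (i + l)) :=
          mul_le_mul (h.norm_stepRatio_le' hA hk ha i l) (hT _) (norm_nonneg _) (by positivity)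
      _ = _ := by rw [mul_pow, pow_add]; ring
  refine ⟨Summable.of_norm_bounded ((Real.summable_pow_div_factorial _).mul_left _) hb, ?_⟩
  refine (tsum_of_norm_bounded ((Real.summable_pow_div_factorial _).hasSum.mul_left _) hb).trans
    (le_of_eq ?_)
  rw [Real.exp_eq_exp_ℝ, NormedSpace.exp_eq_tsum_div]
  ring

/-- Growth `‖z‖^i` in the outer index survives each summation, since the factorial decay of the
ratio makes the sum over `l` cost only an exponential constant. -/
theorem Indicial.norm_tail_le (h : Indicial lam γ) {ω : ℂ} {a : ℕ → ℂ} {A D : ℝ} (hA : 0 ≤ A)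
    (hD : 0 ≤ D) (hw : ∀ k i : ℕ, ‖stepWeight lam γ ω k i‖ ≤ D / (1 + k)) (z : ℂ) (m k : ℕ)
    (hk : 1 ≤ k) (ha : ∀ j ≤ k + m, ‖a j‖ ≤ A + j / 2) :
    ∃ K : ℝ, ∀ i, ‖tail lam γ ω a z m k i‖ ≤ K * ‖z‖ ^ i := by
  induction m generalizing k with
  | zero =>
    refine ⟨1 * Real.exp ((1 + 2 * A) * ‖z‖), fun i => ?_⟩
    exact (h.summable_stepRatio_mul hA hk (ha k le_rfl) (T := fun j => z ^ j) (K := 1)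
      (by simp) i).2
  | succ m ih =>
    obtain ⟨K, hK⟩ := ih (k + 1) (by omega) fun j hj => ha j (by omega)
    refine ⟨D * K * Real.exp ((1 + 2 * A) * ‖z‖), fun i => ?_⟩
    refine (h.summable_stepRatio_mul hA hk (ha k (by omega))
      (T := fun j => stepWeight lam γ ω k j * tail lam γ ω a z m (k + 1) j) (K := D * K)
      (fun i => ?_) i).2
    rw [norm_mul, mul_assoc]
    refine mul_le_mul ((hw k i).trans ?_) (hK i) (norm_nonneg _) hD
    exact div_le_self hD (by simp)

theorem Indicial.norm_stepWeight_mul_tail_le (h : Indicial lam γ) (ω : ℂ) (a : ℕ → ℂ) (z : ℂ)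
    (m k : ℕ) : ∃ K : ℝ, ∀ i,
      ‖stepWeight lam γ ω k i * tail lam γ ω a z m (k + 1) i‖ ≤ K * ‖z‖ ^ i := by
  obtain ⟨A, hA, ha⟩ := exists_norm_le a (k + 1 + m)
  obtain ⟨D, hD, hw⟩ := h.norm_stepWeight_le ω
  obtain ⟨K, hK⟩ := h.norm_tail_le hA hD hw z m (k + 1) (by omega) ha
  refine ⟨D * K, fun i => ?_⟩
  rw [norm_mul, mul_assoc]
  refine mul_le_mul ((hw k i).trans ?_) (hK i) (norm_nonneg _) hD
  exact div_le_self hD (by simp)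

/-- One interchange of sums: collecting the terms with `i + l = j` yields the recursion defining
`coeff`. It serves both to unfold the nested sums and, with `T j = w^j`, to recognise the result of
an integration. -/
theorem Indicial.tsum_coeff_mul_tsum_stepRatio (h : Indicial lam γ) (ω : ℂ) (a : ℕ → ℂ) (m : ℕ)
    {T : ℕ → ℂ} {K Y : ℝ} (hT : ∀ i, ‖T i‖ ≤ K * Y ^ i) :
    ∑' i, coeff lam γ ω a m i * stepWeight lam γ ω m i *
        ∑' l, stepRatio lam γ (a (m + 1)) (m + 1) i (i + l) * T (i + l) =
      ∑' j, coeff lam γ ω a (m + 1) j * T j := by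
  obtain ⟨A, hA, ha⟩ := exists_norm_le a (m + 1)
  obtain ⟨D, hD, hw⟩ := h.norm_stepWeight_le ω
  refine tsum_tsum_mul_eq_tsum_sum (c := fun i => coeff lam γ ω a m i * stepWeight lam γ ω m i)
    (R := fun i j => stepRatio lam γ (a (m + 1)) (m + 1) i j)
    (K := D ^ m / (m.factorial : ℝ) * 2 ^ m * D * K) (X := 2 * (1 + 2 * A) * Y)
    (Y := (1 + 2 * A) * Y) fun i l => ?_
  have e1 := h.norm_coeff_le hA hD hw m (fun k hk => ha k (by omega)) i
  have e2 : ‖stepWeight lam γ ω m i‖ ≤ D :=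
    (hw m i).trans (div_le_self hD (by simp))
  have e3 := h.norm_stepRatio_le' hA (Nat.le_add_left 1 m) (ha (m + 1) le_rfl) i l
  rw [norm_mul, norm_mul, norm_mul]
  calc _ ≤ _ := mul_le_mul (mul_le_mul e1 e2 (norm_nonneg _) (by positivity))
        (mul_le_mul e3 (hT (i + l)) (norm_nonneg _) (by positivity)) (by positivity) (by positivity)
    _ = _ := by rw [mul_pow, mul_pow, mul_pow, pow_add, pow_add]; ring

/-- Summing from the inside or from the outside gives the same sub-power series. -/
theorem Indicial.tsum_coeff_mul_tail (h : Indicial lam γ) (ω : ℂ) (a : ℕ → ℂ) (z : ℂ) (n m : ℕ) :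
    ∑' i, coeff lam γ ω a m i * stepWeight lam γ ω m i * tail lam γ ω a z n (m + 1) i =
      ∑' j, coeff lam γ ω a (m + n + 1) j * z ^ j := by
  induction n generalizing m with
  | zero =>
    exact h.tsum_coeff_mul_tsum_stepRatio ω a m (T := fun j => z ^ j) (K := 1) (Y := ‖z‖) (by simp)
  | succ n ih =>
    obtain ⟨K, hK⟩ := h.norm_stepWeight_mul_tail_le ω a z n (m + 1)
    simp only [tail]
    rw [h.tsum_coeff_mul_tsum_stepRatio ω a m hK, show m + (n + 1) + 1 = m + 1 + n + 1 by ring,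
      ← ih (m + 1)]
    simp only [mul_assoc]

/-- For `a m = -β m` this is the vanishing of the coefficients beyond degree `β m`. -/
theorem coeff_eq_zero {ω : ℂ} {a : ℕ → ℂ} {m j : ℕ} (h : rf (a m) j = 0) :
    coeff lam γ ω a m j = 0 := by
  cases m with
  | zero => simp [coeff, startCoeff, h]
  | succ m => exact Finset.sum_eq_zero fun i _ => by rw [stepRatio_eq_zero_of_right h, mul_zero]

/-! ### Identification with the power series of the statement -/

/-- Makes the polynomial case an instance of the infinite one. It also covers `i > b`, where the
interval is empty and all terms on the right vanish. -/
theorem sum_Icc_eq_tsum {F : ℕ → ℂ} {b : ℕ} (hF : ∀ j, b < j → F j = 0) (i : ℕ) :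
    ∑ j ∈ Finset.Icc i b, F j = ∑' l, F (i + l) := by
  have : Finset.Icc i b = Finset.Ico i (b + 1) := by ext; simp
  rw [this, Finset.sum_Ico_eq_sum_range, tsum_eq_sum]
  intro l hl
  apply hF
  have := Finset.mem_range.not.1 hl
  omega

theorem polyTail_eq (ω : ℂ) (β : ℕ → ℕ) (z : ℂ) (m k i : ℕ) :
    polyTail lam γ ω β z m k i = tail lam γ ω (fun k => -(β k : ℂ)) z m k i := by
  induction m generalizing k i with
  | zero =>
    rw [polyTail, tail, sum_Icc_eq_tsum]
    intro j hj
    rw [stepRatio_eq_zero_of_right (rf_neg_natCast_eq_zero hj), zero_mul]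
  | succ m ih =>
    simp only [polyTail, tail, ih]
    rw [sum_Icc_eq_tsum]
    · congr 1; ext l; ring
    · intro j hj
      rw [stepRatio_eq_zero_of_right (rf_neg_natCast_eq_zero hj), mul_zero, zero_mul]

theorem Indicial.polyTerm_eq (h : Indicial lam γ) (ω : ℂ) (β : ℕ → ℕ) (z : ℂ) (n : ℕ) :
    polyTerm lam γ ω β z n = ∑' j, coeff lam γ ω (fun k => -(β k : ℂ)) n j * z ^ j := by
  have h0 : ∀ j, β 0 < j → startCoeff lam γ (-(β 0 : ℂ)) j = 0 := fun j hj => by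
    rw [startCoeff, rf_neg_natCast_eq_zero hj, zero_div]
  cases n with
  | zero =>
    rw [polyTerm, sum_Icc_eq_tsum]
    · simp [coeff]
    · intro j hj; rw [h0 j hj, zero_mul]
  | succ n =>
    have := h.tsum_coeff_mul_tail ω (fun k => -(β k : ℂ)) z n 0
    rw [zero_add, zero_add] at this
    rw [← this, polyTerm, sum_Icc_eq_tsum]
    · simp only [polyTail_eq, coeff, zero_add]
      congr 1; ext l; ring
    · intro j hj; rw [h0 j hj, mul_zero, zero_mul]

theorem infTail_eq (ω q z : ℂ) (m k i : ℕ) :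
    infTail lam γ ω q z m k i = tail lam γ ω (fun k => q + k / 2 + lam / 2) z m k i := by
  induction m generalizing k i with
  | zero => rfl
  | succ m ih =>
    simp only [infTail, tail, infSummand, ih]

theorem infStart_zero_eq (ω q z : ℂ) (i : ℕ) : infStart lam γ ω q z 0 i =
    coeff lam γ ω (fun k => q + k / 2 + lam / 2) 0 i * z ^ i := by
  simp [infStart, coeff]

theorem infStart_succ_eq (ω q z : ℂ) (n i : ℕ) : infStart lam γ ω q z (n + 1) i =
    coeff lam γ ω (fun k => q + k / 2 + lam / 2) 0 i * (stepWeight lam γ ω 0 i *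
      tail lam γ ω (fun k => q + k / 2 + lam / 2) z n 1 i) := by
  simp only [infStart, coeff, infTail_eq, Nat.cast_zero, zero_div, add_zero]
  ring

theorem Indicial.infTerm_eq (h : Indicial lam γ) (ω q z : ℂ) (n : ℕ) :
    infTerm lam γ ω q z n = ∑' j, coeff lam γ ω (fun k => q + k / 2 + lam / 2) n j * z ^ j := by
  cases n with
  | zero => simp only [infTerm, infStart_zero_eq]
  | succ n =>
    have := h.tsum_coeff_mul_tail ω (fun k => q + k / 2 + lam / 2) z n 0
    rw [zero_add, zero_add] at this
    rw [← this, infTerm]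
    simp only [infStart_succ_eq, mul_assoc]

theorem norm_infParam_le (lam q : ℂ) (k : ℕ) : ‖q + k / 2 + lam / 2‖ ≤ ‖q + lam / 2‖ + k / 2 := by
  have : q + k / 2 + lam / 2 = (q + lam / 2) + k / 2 := by ring
  rw [this]
  simpa using norm_add_le (q + lam / 2) ((k : ℂ) / 2)

theorem Indicial.infSumsConverge (h : Indicial lam γ) (ω q z : ℂ) :
    InfSumsConverge lam γ ω q z := by
  have hs := fun k => norm_infParam_le lam q k
  have hA := norm_nonneg (q + lam / 2)
  refine ⟨fun n => ?_, fun k i hk => ?_, fun m k i hk => ?_⟩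
  · cases n with
    | zero =>
      rw [funext (infStart_zero_eq ω q z)]
      exact (h.expBound_coeff ω (fun k => q + k / 2 + lam / 2) 0).summable z
    | succ n =>
      rw [funext (infStart_succ_eq ω q z n)]
      obtain ⟨K, hK⟩ := h.norm_stepWeight_mul_tail_le ω (fun k => q + k / 2 + lam / 2) z n 0
      refine Summable.of_norm_bounded (((h.expBound_coeff ω (fun k => q + k / 2 + lam / 2)
        0).summable_norm ‖z‖).mul_left K) fun i => ?_
      rw [norm_mul]
      calc _ ≤ _ := mul_le_mul_of_nonneg_left (hK i) (norm_nonneg _)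
        _ = _ := by ring
  · exact (h.summable_stepRatio_mul hA hk (hs k) (T := fun j => z ^ j) (K := 1) (Y := ‖z‖)
      (by simp) i).1
  · obtain ⟨K, hK⟩ := h.norm_stepWeight_mul_tail_le ω (fun k => q + k / 2 + lam / 2) z m k
    simp only [infTail_eq]
    exact (h.summable_stepRatio_mul hA hk (hs k) hK i).1

/-! ### Contour integrals -/

/-- On the compact circle `φ`, `ψ` and `v` are bounded, so the expanded double series is dominated
by a product of exponential series and may be integrated term by term. -/
theorem circleIntegral_exp_mul_tsum {c : ℂ} {r : ℝ} (hr : 0 ≤ r) {φ ψ : ℂ → ℂ}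
    (hφ : ContinuousOn φ (Metric.sphere c r)) (hψ : ContinuousOn ψ (Metric.sphere c r))
    {g : ℕ → ℂ} (hg : ExpBound g) (X y : ℂ) :
    (∮ v in C(c, r), Complex.exp (φ v * X) * ψ v * ∑' i, g i * (y * v) ^ i) =
      ∑' x : ℕ × ℕ, g x.1 * (y ^ x.1 * X ^ x.2) / (x.2.factorial : ℂ) *
        ∮ v in C(c, r), φ v ^ x.2 * v ^ x.1 * ψ v := by
  obtain ⟨P, hP⟩ := (isCompact_sphere c r).exists_bound_of_continuousOn hφ
  obtain ⟨Q, hQ⟩ := (isCompact_sphere c r).exists_bound_of_continuousOn hψ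
  obtain ⟨V, hV⟩ := (isCompact_sphere c r).exists_bound_of_continuousOn
    (continuousOn_id (s := Metric.sphere c r))
  obtain ⟨K, Z, hK, hZ, hgb⟩ := hg
  set F : ℕ × ℕ → ℂ → ℂ := fun x v =>
    g x.1 * (y ^ x.1 * X ^ x.2) / (x.2.factorial : ℂ) * (φ v ^ x.2 * v ^ x.1 * ψ v) with hF
  have hFc : ∀ x, ContinuousOn (F x) (Metric.sphere c r) := fun x => by
    simp only [hF]; fun_prop
  set b : ℕ × ℕ → ℝ := fun x => K * Q * ((Z * ‖y‖ * V) ^ x.1 / (x.1.factorial : ℝ) *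
    ((P * ‖X‖) ^ x.2 / (x.2.factorial : ℝ))) with hb
  have hbs : Summable b := (summable_exp_prod _ _).mul_left _
  have hFb : ∀ x, ∀ v ∈ Metric.sphere c r, ‖F x v‖ ≤ b x := by
    intro x v hv
    have e1 := hP v hv
    have e2 := hQ v hv
    have e3 := hV v hv
    have e4 := hgb x.1
    have hP0 := (norm_nonneg _).trans e1
    have hQ0 := (norm_nonneg _).trans e2
    have hV0 := (norm_nonneg _).trans e3
    simp only [id] at e3
    simp only [hF, hb, norm_mul, norm_div, norm_pow, Complex.norm_natCast]
    calc _ ≤ (K * (Z ^ x.1 / (x.1.factorial : ℝ))) * (‖y‖ ^ x.1 * ‖X‖ ^ x.2) /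
          (x.2.factorial : ℝ) * (P ^ x.2 * V ^ x.1 * Q) := by gcongr
      _ = _ := by rw [mul_pow, mul_pow, mul_pow]; ring
  have hsum : ∀ v ∈ Metric.sphere c r,
      HasSum (fun x => F x v) (Complex.exp (φ v * X) * ψ v * ∑' i, g i * (y * v) ^ i) := by
    intro v hv
    have hs : Summable (fun x => F x v) := Summable.of_norm_bounded hbs fun x => hFb x v hv
    have : ∑' x, F x v = Complex.exp (φ v * X) * ψ v * ∑' i, g i * (y * v) ^ i := by
      rw [hs.tsum_prod, ← tsum_mul_left]
      congr 1
      ext i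
      rw [Complex.exp_eq_exp_ℂ, NormedSpace.exp_eq_tsum_div, ← tsum_mul_right, ← tsum_mul_right]
      congr 1
      ext k
      simp only [hF]
      rw [mul_pow, mul_pow]
      ring
    rw [← this]
    exact hs.hasSum
  have hmem : ∀ θ : ℝ, circleMap c r θ ∈ Metric.sphere c r := fun θ => circleMap_mem_sphere c hr θ
  have hderiv : ∀ θ : ℝ, ‖deriv (circleMap c r) θ‖ = r := fun θ => by
    simp [deriv_circleMap, abs_of_nonneg hr]
  have main : HasSum (fun x => ∮ v in C(c, r), F x v)
      (∮ v in C(c, r), Complex.exp (φ v * X) * ψ v * ∑' i, g i * (y * v) ^ i) := by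
    refine intervalIntegral.hasSum_integral_of_dominated_convergence (fun x _ => r * b x)
      (fun x => ?_) (fun x => ?_) ?_ ?_ ?_
    · have hFm := (hFc x).comp_continuous (continuous_circleMap c r) hmem
      have hdm : Continuous (deriv (circleMap c r)) := ?_
      · exact (hdm.smul hFm).aestronglyMeasurable
      have : deriv (circleMap c r) = fun θ => circleMap 0 r θ * Complex.I :=
        funext fun θ => deriv_circleMap c r θ
      rw [this]
      exact (continuous_circleMap 0 r).mul continuous_const
    · refine Eventually.of_forall fun θ _ => ?_
      rw [norm_smul, hderiv]
      exact mul_le_mul_of_nonneg_left (hFb x _ (hmem θ)) hr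
    · exact Eventually.of_forall fun θ _ => hbs.mul_left r
    · exact intervalIntegrable_const
    · exact Eventually.of_forall fun θ _ => (hsum _ (hmem θ)).const_smul _
  rw [← main.tsum_eq]
  congr 1
  ext x
  simp only [hF, circleIntegral.integral_const_mul]

/-- Integration by parts: `E (k+1) / (v-1)^(k+1)` is single-valued on the circle, so its derivative
integrates to zero. `E k` stands for `v^(A+k-1)`; keeping it abstract serves integer powers around
`0` and principal powers around `1` alike. -/
theorem circleIntegral_mul_inv_pow {c : ℂ} {r : ℝ} (hr : 0 ≤ r) {E : ℕ → ℂ → ℂ} {A : ℂ}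
    (hE0 : ContinuousOn (E 0) (Metric.sphere c r))
    (hE : ∀ k, ∀ v ∈ Metric.sphere c r, HasDerivAt (E (k + 1)) ((A + k) * E k v) v)
    (h1 : ∀ v ∈ Metric.sphere c r, v - 1 ≠ 0) (k : ℕ) :
    (∮ v in C(c, r), E k v * ((v - 1) ^ (k + 1))⁻¹) =
      rf A k / (k.factorial : ℂ) * ∮ v in C(c, r), E 0 v * (v - 1)⁻¹ := by
  have hEc : ∀ k, ContinuousOn (E k) (Metric.sphere c r) := fun k => by
    cases k with
    | zero => exact hE0
    | succ k => exact fun v hv => (hE k v hv).continuousAt.continuousWithinAt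
  have hic : ∀ k, ContinuousOn (fun v : ℂ => ((v - 1) ^ (k + 1))⁻¹) (Metric.sphere c r) :=
    fun k => ContinuousOn.inv₀ (by fun_prop) fun v hv => pow_ne_zero _ (h1 v hv)
  induction k with
  | zero => simp
  | succ k ih =>
    have hz : (∮ v in C(c, r), ((A + k) * (E k v * ((v - 1) ^ (k + 1))⁻¹) -
        (k + 1) * (E (k + 1) v * ((v - 1) ^ (k + 1 + 1))⁻¹))) = 0 := by
      refine circleIntegral.integral_eq_zero_of_hasDerivWithinAt hr
        (f := fun v => E (k + 1) v * ((v - 1) ^ (k + 1))⁻¹) fun v hv => ?_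
      have hv1 := h1 v hv
      have hd : HasDerivAt (fun v : ℂ => ((v - 1) ^ (k + 1))⁻¹)
          (-((k + 1 : ℕ) * (v - 1) ^ k * 1) / ((v - 1) ^ (k + 1)) ^ 2) v :=
        (((hasDerivAt_id v).sub_const 1).pow (k + 1)).inv (pow_ne_zero _ hv1)
      have hd2 := ((hE k v hv).mul hd).hasDerivWithinAt (s := Metric.sphere c r)
      have e : (A + k) * (E k v * ((v - 1) ^ (k + 1))⁻¹) -
          (k + 1) * (E (k + 1) v * ((v - 1) ^ (k + 1 + 1))⁻¹) =
          (A + k) * E k v * ((v - 1) ^ (k + 1))⁻¹ +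
            E (k + 1) v * (-((k + 1 : ℕ) * (v - 1) ^ k * 1) / ((v - 1) ^ (k + 1)) ^ 2) := by
        push_cast
        field_simp
        ring
      rw [e]
      exact hd2
    rw [circleIntegral.integral_sub, circleIntegral.integral_const_mul,
      circleIntegral.integral_const_mul, ih] at hz
    · have hk : (k + 1 : ℂ) ≠ 0 := Nat.cast_add_one_ne_zero k
      have hk' : (k.factorial : ℂ) ≠ 0 := by exact_mod_cast k.factorial_ne_zero
      rw [rf_succ, Nat.factorial_succ]
      push_cast
      field_simp at hz ⊢
      linear_combination -hz
    · exact ContinuousOn.circleIntegrable hr (continuousOn_const.mul ((hEc k).mul (hic k)))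
    · exact ContinuousOn.circleIntegrable hr
        (continuousOn_const.mul ((hEc (k + 1)).mul (hic (k + 1))))

/-- The contour integral acts on monomials as the contour representation of the Laguerre functions
`∑ (a + i)_k X ^ k / (k !) ^ 2`. -/
def ContourSpec (C : ℂ → (ℂ → ℂ) → ℂ) (a : ℂ) : Prop :=
  ∀ g : ℕ → ℂ, ExpBound g → (∀ i, g i ≠ 0 → rf a i ≠ 0) → ∀ X y : ℂ,
    C X (fun v => ∑' i, g i * (y * v) ^ i) =
      ∑' x : ℕ × ℕ, g x.1 * (rf (a + x.1) x.2 / (x.2.factorial : ℂ) ^ 2) * (y ^ x.1 * X ^ x.2)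

/-- Partial fractions: `v^(m-1)/(v-1) = v^m/(v-1) - v^(m-1)`. Lowering the exponent changes the
integral only when passing `v^(-1)`, which contributes `-2πi`; before that the integrand is
holomorphic in the disc. -/
theorem circleIntegral_zpow_div_sub_one {r : ℝ} (hr : 0 < r) (hr1 : r < 1) (n : ℕ) :
    (∮ v in C(0, r), v ^ (-(n : ℤ) - 1) * (v - 1)⁻¹) = -(2 * Real.pi * Complex.I) := by
  have hv0 : ∀ v ∈ Metric.sphere (0 : ℂ) r, v ≠ 0 := fun v hv h => by
    have := mem_sphere_zero_iff_norm.1 hv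
    rw [h, norm_zero] at this
    linarith
  have hv1 : ∀ v ∈ Metric.closedBall (0 : ℂ) r, v - 1 ≠ 0 := fun v hv h => by
    have := mem_closedBall_zero_iff.1 hv
    rw [sub_eq_zero.1 h, norm_one] at this
    linarith
  have hc1 : ContinuousOn (fun v : ℂ => (v - 1)⁻¹) (Metric.closedBall (0 : ℂ) r) :=
    ContinuousOn.inv₀ (by fun_prop) hv1
  have hcz : ∀ m : ℤ, ContinuousOn (fun v : ℂ => v ^ m) (Metric.sphere (0 : ℂ) r) :=
    fun m v hv => (continuousAt_zpow₀ v m (Or.inl (hv0 v hv))).continuousWithinAt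
  have hc1' := hc1.mono Metric.sphere_subset_closedBall
  have hsplit : ∀ m : ℤ, (∮ v in C(0, r), v ^ (m - 1) * (v - 1)⁻¹) =
      (∮ v in C(0, r), v ^ m * (v - 1)⁻¹) - ∮ v in C(0, r), v ^ (m - 1) := by
    intro m
    rw [← circleIntegral.integral_sub]
    · refine circleIntegral.integral_congr hr.le fun v hv => ?_
      have h0 := hv0 v hv
      have h1 := hv1 v (Metric.sphere_subset_closedBall hv)
      rw [zpow_sub_one₀ h0]
      field_simp
      ring
    · exact ContinuousOn.circleIntegrable hr.le ((hcz m).mul hc1')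
    · exact ContinuousOn.circleIntegrable hr.le (hcz (m - 1))
  induction n with
  | zero =>
    have h := hsplit 0
    have e1 : (∮ v in C(0, r), v ^ (0 : ℤ) * (v - 1)⁻¹) = 0 := by
      simp only [zpow_zero, one_mul]
      refine Complex.circleIntegral_eq_zero_of_differentiable_on_off_countable hr.le
        Set.countable_empty hc1 fun v hv => ?_
      have := hv1 v (Metric.ball_subset_closedBall hv.1)
      fun_prop (disch := assumption)
    have e2 : (∮ v in C(0, r), (v : ℂ) ^ (0 - 1 : ℤ)) = 2 * Real.pi * Complex.I := by
      have := circleIntegral.integral_sub_inv_of_mem_ball (Metric.mem_ball_self hr : (0 : ℂ) ∈ _)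
      simpa using this
    rw [e1, e2, zero_sub] at h
    simpa using h
  | succ n ih =>
    have h := hsplit (-(n : ℤ) - 1)
    have e2 : (∮ v in C(0, r), (v : ℂ) ^ (-(n : ℤ) - 1 - 1)) = 0 := by
      have := circleIntegral.integral_sub_zpow_of_ne (n := -(n : ℤ) - 1 - 1) (by omega) 0 0 r
      simpa using this
    rw [ih, e2, sub_zero] at h
    rw [← h]
    push_cast
    congr 1
    ext v
    congr 2
    ring

/-- For `i ≤ b`, put `b = i + n`; up to sign the integrand is `v^(-n+k-1)/(v-1)^(k+1)`, and `-n = -b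
+ i`. For `i > b` the integral would vanish while `(i-b)_k` does not, hence the nonvanishing
condition in `ContourSpec`. -/
theorem contourSpec_polyContour {r : ℝ} (hr : 0 < r) (hr1 : r < 1) (b : ℕ) :
    ContourSpec (polyContour r b) (-(b : ℂ)) := by
  intro g hg hgb X y
  have hv0 : ∀ v ∈ Metric.sphere (0 : ℂ) r, v ≠ 0 := fun v hv h => by
    have := mem_sphere_zero_iff_norm.1 hv
    rw [h, norm_zero] at this
    linarith
  have hv1 : ∀ v ∈ Metric.sphere (0 : ℂ) r, v - 1 ≠ 0 := fun v hv h => by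
    have := mem_sphere_zero_iff_norm.1 hv
    rw [sub_eq_zero.1 h, norm_one] at this
    linarith
  have hv1' : ∀ v ∈ Metric.sphere (0 : ℂ) r, 1 - v ≠ 0 := fun v hv h =>
    hv1 v hv (by linear_combination -h)
  have hφ : ContinuousOn (fun v : ℂ => -(v / (1 - v))) (Metric.sphere 0 r) :=
    (ContinuousOn.div continuousOn_id (by fun_prop) hv1').neg
  have hψ : ContinuousOn (fun v : ℂ => (v ^ (b + 1) * (1 - v))⁻¹) (Metric.sphere 0 r) :=
    ContinuousOn.inv₀ (by fun_prop) fun v hv => mul_ne_zero (pow_ne_zero _ (hv0 v hv)) (hv1' v hv)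
  rw [polyContour]
  simp only [div_eq_mul_inv (Complex.exp _)]
  rw [circleIntegral_exp_mul_tsum hr.le hφ hψ hg, ← tsum_mul_left]
  congr 1
  ext ⟨i, k⟩
  by_cases hgi : g i = 0
  · simp [hgi]
  obtain ⟨n, rfl⟩ := Nat.exists_eq_add_of_le (rf_neg_natCast_ne_zero_iff.1 (hgb i hgi))
  have key := circleIntegral_mul_inv_pow (c := 0) hr.le (A := -(n : ℂ))
    (E := fun k v => v ^ (-(n : ℤ) + k - 1))
    (fun v hv => (continuousAt_zpow₀ v _ (Or.inl (hv0 v hv))).continuousWithinAt)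
    (fun k v hv => by
      have hd := hasDerivAt_zpow (-(n : ℤ) + (k + 1 : ℕ) - 1) v (Or.inl (hv0 v hv))
      have e : -(n : ℤ) + (k + 1 : ℕ) - 1 - 1 = -(n : ℤ) + k - 1 := by push_cast; ring
      have e' : ((-(n : ℤ) + (k + 1 : ℕ) - 1 : ℤ) : ℂ) = -(n : ℂ) + k := by push_cast; ring
      rwa [e, e'] at hd) hv1 k
  have e0 : (∮ v in C(0, r), v ^ (-(n : ℤ) + ((0 : ℕ) : ℤ) - 1) * (v - 1)⁻¹) =
      -(2 * Real.pi * Complex.I) := by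
    simpa using circleIntegral_zpow_div_sub_one hr hr1 n
  rw [e0] at key
  have e1 : (∮ v in C(0, r), (-(v / (1 - v))) ^ k * v ^ i * (v ^ (i + n + 1) * (1 - v))⁻¹) =
      -∮ v in C(0, r), v ^ (-(n : ℤ) + k - 1) * ((v - 1) ^ (k + 1))⁻¹ := by
    rw [← neg_one_mul, ← circleIntegral.integral_const_mul]
    refine circleIntegral.integral_congr hr.le fun v hv => ?_
    have h0 := hv0 v hv
    have h1 := hv1 v hv
    have h1' := hv1' v hv
    have e2 : -(v / (1 - v)) = v / (v - 1) := by
      rw [← div_neg]; congr 1; ring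
    have e3 : (1 - v) = -(v - 1) := by ring
    rw [e2, e3, zpow_sub_one₀ h0, zpow_add₀ h0, zpow_neg, zpow_natCast, zpow_natCast, div_pow,
      pow_succ v, pow_add v]
    field_simp
    ring
  rw [e1, key]
  have hI := Complex.two_pi_I_ne_zero
  have : (-((i + n : ℕ) : ℂ) + i) = -(n : ℂ) := by push_cast; ring
  rw [this]
  field_simp

/-- The closed disc around `1` lies in the slit plane, so principal powers are holomorphic there and
the case `k = 0` is Cauchy's formula with value `1`. The clockwise orientation compensates `1 - v =
-(v - 1)`. -/
theorem contourSpec_infContour {r : ℝ} (hr : 0 < r) (hr1 : r < 1) (a : ℂ) :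
    ContourSpec (infContour r a) a := by
  intro g hg _ X y
  have hsl : ∀ v ∈ Metric.closedBall (1 : ℂ) r, v ∈ Complex.slitPlane := fun v hv => by
    refine Complex.ball_one_subset_slitPlane ?_
    exact lt_of_le_of_lt hv hr1
  have hsl' := fun v (hv : v ∈ Metric.sphere (1 : ℂ) r) =>
    hsl v (Metric.sphere_subset_closedBall hv)
  have hv0 := fun v (hv : v ∈ Metric.sphere (1 : ℂ) r) => Complex.slitPlane_ne_zero (hsl' v hv)
  have hv1 : ∀ v ∈ Metric.sphere (1 : ℂ) r, v - 1 ≠ 0 := fun v hv h => by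
    have := mem_sphere_iff_norm.1 hv
    rw [h, norm_zero] at this
    linarith
  have hv1' : ∀ v ∈ Metric.sphere (1 : ℂ) r, 1 - v ≠ 0 := fun v hv h =>
    hv1 v hv (by linear_combination -h)
  have hcp : ∀ (e : ℂ), ∀ v ∈ Metric.closedBall (1 : ℂ) r,
      HasDerivAt (fun v : ℂ => v ^ e) (e * v ^ (e - 1)) v := fun e v hv => by
    simpa using (hasDerivAt_id v).cpow_const (c := e) (hsl v hv)
  have hcc : ∀ (e : ℂ), ContinuousOn (fun v : ℂ => v ^ e) (Metric.closedBall (1 : ℂ) r) :=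
    fun e v hv => (hcp e v hv).continuousAt.continuousWithinAt
  have hφ : ContinuousOn (fun v : ℂ => -(v / (1 - v))) (Metric.sphere 1 r) :=
    (ContinuousOn.div continuousOn_id (by fun_prop) hv1').neg
  have hψ : ContinuousOn (fun v : ℂ => (v ^ (-a + 1) * (1 - v))⁻¹) (Metric.sphere 1 r) :=
    ContinuousOn.inv₀ (((hcc _).mono Metric.sphere_subset_closedBall).mul (by fun_prop))
      fun v hv => mul_ne_zero (by simp [Complex.cpow_eq_zero_iff, hv0 v hv]) (hv1' v hv)
  rw [infContour]
  simp only [div_eq_mul_inv (Complex.exp _)]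
  rw [circleIntegral_exp_mul_tsum hr.le hφ hψ hg, ← tsum_neg, ← tsum_mul_left]
  congr 1
  ext ⟨i, k⟩
  have key := circleIntegral_mul_inv_pow (c := 1) hr.le (A := a + i)
    (E := fun k v => v ^ (a + i + k - 1))
    ((hcc _).mono Metric.sphere_subset_closedBall)
    (fun k v hv => by
      convert hcp (a + i + (k + 1 : ℕ) - 1) v (Metric.sphere_subset_closedBall hv) using 2
      · push_cast; ring
      · push_cast; ring_nf) hv1 k
  have e0 : (∮ v in C(1, r), v ^ (a + i + ((0 : ℕ) : ℂ) - 1) * (v - 1)⁻¹) =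
      2 * Real.pi * Complex.I := by
    have := Complex.circleIntegral_sub_center_inv_smul_of_differentiable_on_off_countable hr
      Set.countable_empty (hcc (a + i + ((0 : ℕ) : ℂ) - 1)) fun v hv =>
        (hcp _ v (Metric.ball_subset_closedBall hv.1)).differentiableAt
    simpa [mul_comm] using this
  rw [e0] at key
  have e1 : (∮ v in C(1, r), (-(v / (1 - v))) ^ k * v ^ i * (v ^ (-a + 1) * (1 - v))⁻¹) =
      -∮ v in C(1, r), v ^ (a + i + k - 1) * ((v - 1) ^ (k + 1))⁻¹ := by
    rw [← neg_one_mul (∮ v in C(1, r), _), ← circleIntegral.integral_const_mul]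
    refine circleIntegral.integral_congr hr.le fun v hv => ?_
    have h0 := hv0 v hv
    have h1 := hv1 v hv
    have e2 : -(v / (1 - v)) = v / (v - 1) := by
      rw [← div_neg]; congr 1; ring
    have e3 : (1 - v) = -(v - 1) := by ring
    have e4 : v ^ (a + i + k - 1) = v ^ i * v ^ k * (v ^ (-a + 1))⁻¹ := by
      rw [← Complex.cpow_neg, ← Complex.cpow_natCast, ← Complex.cpow_natCast,
        ← Complex.cpow_add _ _ h0, ← Complex.cpow_add _ _ h0]
      congr 1
      ring
    have h5 : v ^ (-a + 1) ≠ 0 := by simp [Complex.cpow_eq_zero_iff, h0]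
    rw [e2, e3, e4, div_pow]
    field_simp
    ring
  rw [e1, key]
  have hI := Complex.two_pi_I_ne_zero
  field_simp

/-! ### The iterated beta integrals -/

theorem integrable_cpow_mul_tsum {ι : Type*} [Countable ι] {e : ℂ} (he : -1 < e.re)
    {F : ι → ℝ → ℂ} {M : ι → ℝ} (hM : Summable M)
    (hFc : ∀ n, ContinuousOn (F n) (Set.Icc 0 1))
    (hb : ∀ n, ∀ u ∈ Set.Icc (0 : ℝ) 1, ‖F n u‖ ≤ M n) :
    IntervalIntegrable (fun u : ℝ => (u : ℂ) ^ e * ∑' n, F n u) volume 0 1 ∧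
      HasSum (fun n => ∫ u in (0 : ℝ)..1, (u : ℂ) ^ e * F n u)
        (∫ u in (0 : ℝ)..1, (u : ℂ) ^ e * ∑' n, F n u) := by
  have hi := intervalIntegral.intervalIntegrable_cpow' (a := 0) (b := 1) he
  have hIcc : Set.uIcc (0 : ℝ) 1 = Set.Icc 0 1 := Set.uIcc_of_le zero_le_one
  have hsub : ∀ u ∈ Set.uIoc (0 : ℝ) 1, u ∈ Set.Icc (0 : ℝ) 1 := fun u hu => by
    rw [Set.uIoc_of_le zero_le_one] at hu
    exact Set.Ioc_subset_Icc_self hu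
  refine ⟨hi.mul_continuousOn (by rw [hIcc]; exact continuousOn_tsum hFc hM hb), ?_⟩
  refine intervalIntegral.hasSum_integral_of_dominated_convergence
    (fun n u => ‖(u : ℂ) ^ e‖ * M n) (fun n => ?_) (fun n => ?_) ?_ ?_ ?_
  · have := (hi.mul_continuousOn (by rw [hIcc]; exact hFc n)).aestronglyMeasurable
    rwa [Set.uIoc_of_le zero_le_one]
  · refine Eventually.of_forall fun u hu => ?_
    rw [norm_mul]
    exact mul_le_mul_of_nonneg_left (hb n u (hsub u hu)) (norm_nonneg _)
  · exact Eventually.of_forall fun u _ => hM.mul_left _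
  · simp only [tsum_mul_left]
    exact hi.norm.mul_const _
  · refine Eventually.of_forall fun u hu => ?_
    exact (Summable.of_norm_bounded hM fun n => hb n u (hsub u hu)).hasSum.mul_left _

theorem integral_cpow_mul_pow_mul_pow {e : ℂ} (he : -1 < e.re) (i k : ℕ) :
    ∫ u in (0 : ℝ)..1, (u : ℂ) ^ e * ((u : ℂ) ^ i * (1 - u) ^ k) =
      (k.factorial : ℂ) / rf (e + 1 + i) (k + 1) := by
  have hp : 0 < (e + 1 + i).re := by
    simp only [Complex.add_re, Complex.one_re, Complex.natCast_re]
    have : (0 : ℝ) ≤ i := i.cast_nonneg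
    linarith
  rw [rf_eq_prod, ← Complex.betaIntegral_eval_nat_add_one_right hp, Complex.betaIntegral]
  refine intervalIntegral.integral_congr_ae (Eventually.of_forall fun u hu => ?_)
  rw [Set.uIoc_of_le zero_le_one] at hu
  have hu0 : (u : ℂ) ≠ 0 := by exact_mod_cast hu.1.ne'
  have e1 : e + 1 + i - 1 = e + i := by ring
  rw [e1, add_sub_cancel_right, Complex.cpow_natCast, Complex.cpow_add _ _ hu0,
    Complex.cpow_natCast]
  ring

theorem norm_pow_mul_pow_le {u : ℝ} (hu : u ∈ Set.Icc (0 : ℝ) 1) (i k : ℕ) :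
    ‖(u : ℂ) ^ i * (1 - u) ^ k‖ ≤ 1 := by
  have h1 : ‖(u : ℂ)‖ ≤ 1 := by
    rw [Complex.norm_real, Real.norm_eq_abs, abs_of_nonneg hu.1]; exact hu.2
  have h2 : ‖(1 - u : ℂ)‖ ≤ 1 := by
    rw [← Complex.ofReal_one, ← Complex.ofReal_sub, Complex.norm_real, Real.norm_eq_abs,
      abs_of_nonneg (by linarith [hu.2])]
    linarith [hu.1]
  rw [norm_mul, norm_pow, norm_pow]
  exact mul_le_one₀ (pow_le_one₀ (norm_nonneg _) h1) (by positivity)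
    (pow_le_one₀ (norm_nonneg _) h2)

theorem norm_integral_cpow_mul_le {e : ℂ} (he : -1 < e.re) (i k : ℕ) :
    ‖∫ u in (0 : ℝ)..1, (u : ℂ) ^ e * ((u : ℂ) ^ i * (1 - u) ^ k)‖ ≤
      ∫ u in (0 : ℝ)..1, ‖(u : ℂ) ^ e‖ := by
  refine intervalIntegral.norm_integral_le_of_norm_le zero_le_one
    (Eventually.of_forall fun u hu => ?_)
    (intervalIntegral.intervalIntegrable_cpow' (a := 0) (b := 1) he).norm
  rw [norm_mul]
  exact mul_le_of_le_one_right (norm_nonneg _) (norm_pow_mul_pow_le (Set.Ioc_subset_Icc_self hu) i k)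

/-- Comparison with an integer `N ≥ ‖a‖`: `(1+N+i)_k = k!` times a binomial coefficient, which is at
most `2^(N+i+k)`. -/
theorem norm_rf_le_two_pow (a : ℂ) :
    ∃ K : ℝ, 0 ≤ K ∧ ∀ i k : ℕ, ‖rf (a + i) k‖ ≤ K * 2 ^ i * 2 ^ k * (k.factorial : ℝ) := by
  obtain ⟨A, hA⟩ := exists_nat_ge ‖a‖
  refine ⟨2 ^ A, by positivity, fun i k => ?_⟩
  have h1 : ‖rf (a + i) k‖ ≤ 1 ^ k * ‖rf (1 + (A + i : ℕ)) k‖ := by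
    refine norm_rf_le_of_forall k fun x => ?_
    have e1 : (1 + (A + i : ℕ) + x : ℂ) = ((1 + (A + i) + x : ℕ) : ℂ) := by push_cast; ring
    have e2 : a + i + x = a + ((i + x : ℕ) : ℂ) := by push_cast; ring
    rw [one_mul, e1, e2, Complex.norm_natCast]
    refine (norm_add_le _ _).trans ?_
    rw [Complex.norm_natCast]
    push_cast
    linarith
  rw [one_pow, one_mul, norm_rf_one_add] at h1
  refine h1.trans ?_
  rw [div_le_iff₀ (by positivity)]
  have h2 := Nat.add_choose_mul_factorial_mul_factorial (A + i) k
  have h3 : (Nat.choose (A + i + k) k : ℝ) ≤ 2 ^ (A + i + k) := by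
    exact_mod_cast Nat.choose_le_two_pow _ _
  rw [← h2]
  push_cast
  calc _ ≤ (2 : ℝ) ^ (A + i + k) * ((A + i).factorial : ℝ) * (k.factorial : ℝ) := by gcongr
    _ = _ := by rw [pow_add, pow_add]; ring

/-- The integral operator of index `m`, without the Euler operator, on power series. -/
theorem integral_tIntegrand {m : ℕ} (ht : -1 < ((m : ℂ) / 2 - 1 + lam / 2).re)
    (hu : -1 < (γ + m / 2 - 2 + lam / 2).re) {C : ℂ → (ℂ → ℂ) → ℂ} {a : ℂ}
    (hC : ContourSpec C a) {g : ℕ → ℂ} (hg : ExpBound g) (hga : ∀ i, g i ≠ 0 → rf a i ≠ 0) (w : ℂ) :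
    (∀ t ∈ Set.Icc (0 : ℝ) 1, IntervalIntegrable
        (uIntegrand lam γ m C (fun s => ∑' i, g i * s ^ i) w t) volume 0 1) ∧
      IntervalIntegrable (tIntegrand lam γ m C (fun s => ∑' i, g i * s ^ i) w) volume 0 1 ∧
      HasSum (fun x : ℕ × ℕ => g x.1 * rf (a + x.1) x.2 /
          (rf ((m : ℂ) / 2 - 1 + lam / 2 + 1 + x.1) (x.2 + 1) *
            rf (γ + m / 2 - 2 + lam / 2 + 1 + x.1) (x.2 + 1)) * w ^ (x.1 + x.2))
        (∫ t in (0 : ℝ)..1, tIntegrand lam γ m C (fun s => ∑' i, g i * s ^ i) w t) := by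
  set et := (m : ℂ) / 2 - 1 + lam / 2 with het
  set eu := γ + m / 2 - 2 + lam / 2 with heu
  set G : ℕ × ℕ → ℂ := fun x =>
    g x.1 * (rf (a + x.1) x.2 / (x.2.factorial : ℂ) ^ 2) * w ^ (x.1 + x.2) with hG
  -- One of the two factors `k!` is spent on `(a+i)_k`; the other leaves a product of exponential
  -- series.
  have hGs : Summable fun x => ‖G x‖ := by
    obtain ⟨K, Z, hK, hZ, hgb⟩ := hg
    obtain ⟨L, hL, hLb⟩ := norm_rf_le_two_pow a
    refine Summable.of_norm_bounded ((summable_exp_prod (2 * Z * ‖w‖) (2 * ‖w‖)).mul_left (K * L))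
      fun x => ?_
    rw [norm_norm]
    simp only [hG, norm_mul, norm_div, norm_pow, Complex.norm_natCast]
    calc _ ≤ K * (Z ^ x.1 / (x.1.factorial : ℝ)) *
          (L * 2 ^ x.1 * 2 ^ x.2 * (x.2.factorial : ℝ) / (x.2.factorial : ℝ) ^ 2) *
            ‖w‖ ^ (x.1 + x.2) := by
          have e1 := hgb x.1
          have e2 := hLb x.1 x.2
          gcongr
      _ = _ := by
          rw [mul_pow, mul_pow, mul_pow, pow_add]
          field_simp
  have hmono : ∀ i k : ℕ, Continuous fun u : ℝ => (u : ℂ) ^ i * (1 - u) ^ k :=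
    fun i k => by fun_prop
  have hU : ∀ t u : ℝ, uIntegrand lam γ m C (fun s => ∑' i, g i * s ^ i) w t u =
      (u : ℂ) ^ eu * ∑' x : ℕ × ℕ,
        G x * ((t : ℂ) ^ x.1 * (1 - t) ^ x.2) * ((u : ℂ) ^ x.1 * (1 - u) ^ x.2) := by
    intro t u
    rw [uIntegrand, hC g hg hga (w * (1 - t) * (1 - u)) (w * t * u)]
    congr 2
    ext x
    simp only [hG]
    rw [mul_pow, mul_pow, mul_pow, mul_pow, pow_add]
    ring
  have hu' : ∀ t ∈ Set.Icc (0 : ℝ) 1, _ := fun t htI =>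
    integrable_cpow_mul_tsum hu (F := fun (x : ℕ × ℕ) (u : ℝ) =>
      G x * ((t : ℂ) ^ x.1 * (1 - t) ^ x.2) * ((u : ℂ) ^ x.1 * (1 - u) ^ x.2)) hGs
      (fun x => (continuous_const.mul (hmono x.1 x.2)).continuousOn) (fun x u huI => by
        rw [norm_mul, norm_mul, mul_assoc]
        exact mul_le_of_le_one_right (norm_nonneg _) (mul_le_one₀ (norm_pow_mul_pow_le htI _ _)
          (norm_nonneg _) (norm_pow_mul_pow_le huI _ _)))
  -- The `u`-integral is taken termwise, with majorant `‖G x‖` uniform in `t`; this uses `t ∈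
  -- [0,1]`.
  have hT : ∀ t ∈ Set.Icc (0 : ℝ) 1, tIntegrand lam γ m C (fun s => ∑' i, g i * s ^ i) w t =
      (t : ℂ) ^ et * ∑' x : ℕ × ℕ, G x * ((t : ℂ) ^ x.1 * (1 - t) ^ x.2) *
        ∫ u in (0 : ℝ)..1, (u : ℂ) ^ eu * ((u : ℂ) ^ x.1 * (1 - u) ^ x.2) := by
    intro t htI
    simp only [tIntegrand, hU]
    rw [← (hu' t htI).2.tsum_eq]
    congr 2
    ext x
    rw [← intervalIntegral.integral_const_mul]
    congr 1
    ext u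
    ring
  have ht' := integrable_cpow_mul_tsum ht (F := fun (x : ℕ × ℕ) (t : ℝ) =>
      G x * ((t : ℂ) ^ x.1 * (1 - t) ^ x.2) *
        ∫ u in (0 : ℝ)..1, (u : ℂ) ^ eu * ((u : ℂ) ^ x.1 * (1 - u) ^ x.2))
      (hGs.mul_right (∫ u in (0 : ℝ)..1, ‖(u : ℂ) ^ eu‖))
      (fun x => ((continuous_const.mul (hmono x.1 x.2)).mul continuous_const).continuousOn)
      (fun x t htI => by
        rw [norm_mul, norm_mul]
        exact mul_le_mul (mul_le_of_le_one_right (norm_nonneg _) (norm_pow_mul_pow_le htI _ _))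
          (norm_integral_cpow_mul_le hu _ _) (norm_nonneg _) (norm_nonneg _))
  have hIcc : Set.uIcc (0 : ℝ) 1 = Set.Icc 0 1 := Set.uIcc_of_le zero_le_one
  refine ⟨fun t htI => ?_, ?_, ?_⟩
  · rw [funext (hU t)]
    exact (hu' t htI).1
  · refine ht'.1.congr fun t htI => (hT t ?_).symm
    rw [Set.uIoc_of_le zero_le_one] at htI
    exact Set.Ioc_subset_Icc_self htI
  · rw [intervalIntegral.integral_congr (g := fun t : ℝ => (t : ℂ) ^ et * ∑' x : ℕ × ℕ,
      G x * ((t : ℂ) ^ x.1 * (1 - t) ^ x.2) *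
        ∫ u in (0 : ℝ)..1, (u : ℂ) ^ eu * ((u : ℂ) ^ x.1 * (1 - u) ^ x.2))
      (fun t htI => hT t (hIcc ▸ htI))]
    convert ht'.2 using 1
    ext x
    have : ∀ t : ℝ, (t : ℂ) ^ et * (G x * ((t : ℂ) ^ x.1 * (1 - t) ^ x.2) *
        ∫ u in (0 : ℝ)..1, (u : ℂ) ^ eu * ((u : ℂ) ^ x.1 * (1 - u) ^ x.2)) =
        (G x * ∫ u in (0 : ℝ)..1, (u : ℂ) ^ eu * ((u : ℂ) ^ x.1 * (1 - u) ^ x.2)) *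
          ((t : ℂ) ^ et * ((t : ℂ) ^ x.1 * (1 - t) ^ x.2)) := fun t => by ring
    simp only [this]
    rw [intervalIntegral.integral_const_mul, integral_cpow_mul_pow_mul_pow ht,
      integral_cpow_mul_pow_mul_pow hu]
    simp only [hG]
    have hk : (x.2.factorial : ℂ) ≠ 0 := by exact_mod_cast x.2.factorial_ne_zero
    generalize rf (et + 1 + x.1) (x.2 + 1) = P
    generalize rf (eu + 1 + x.1) (x.2 + 1) = Q
    field_simp

/-- One more integration turns the coefficients of one sub-power series into those of the next. -/
theorem Indicial.nested_succ (h : Indicial lam γ) {ω K : ℂ} {a : ℕ → ℂ}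
    {C : ℕ → ℂ → (ℂ → ℂ) → ℂ} {f : ℂ → ℂ} {m : ℕ}
    (hC : ContourSpec (C (m + 1)) (a (m + 1))) (ha : ∀ i, rf (a m) i ≠ 0 → rf (a (m + 1)) i ≠ 0)
    (hm : nested lam γ ω C f m = fun w => ∑' i, (K * coeff lam γ ω a m i) * w ^ i) (w : ℂ) :
    (∀ t ∈ Set.Icc (0 : ℝ) 1, IntervalIntegrable (uIntegrand lam γ (m + 1) (C (m + 1))
        (eulerOp lam ω (m + 1) (nested lam γ ω C f m)) w t) volume 0 1) ∧
      IntervalIntegrable (tIntegrand lam γ (m + 1) (C (m + 1))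
        (eulerOp lam ω (m + 1) (nested lam γ ω C f m)) w) volume 0 1 ∧
      nested lam γ ω C f (m + 1) w = ∑' i, (K * coeff lam γ ω a (m + 1) i) * w ^ i := by
  have hc : ExpBound fun i => K * coeff lam γ ω a m i := (h.expBound_coeff ω a m).const_mul K
  set σ : ℂ := (((m + 1 : ℕ) : ℂ) - 1 + ω + lam) / 2 with hσ
  have hop : eulerOp lam ω (m + 1) (nested lam γ ω C f m) =
      fun s => ∑' i : ℕ, ((i + σ) * (K * coeff lam γ ω a m i)) * s ^ i := by
    funext s
    rw [hm, eulerOp_tsum hc]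
  -- The critical case is `m = 0`, where this condition is exactly `Indicial.left`, and the one on
  -- the `u`-weight below is exactly `Indicial.right`.
  have ht : -1 < (((m + 1 : ℕ) : ℂ) / 2 - 1 + lam / 2).re := by
    have := h.left
    have hm0 : (0 : ℝ) ≤ m := m.cast_nonneg
    simp only [Complex.add_re, Complex.sub_re, Complex.natCast_re, Complex.div_ofNat_re,
      Complex.one_re] at this ⊢
    push_cast
    linarith
  have hu : -1 < (γ + ((m + 1 : ℕ) : ℂ) / 2 - 2 + lam / 2).re := by
    have := h.right
    have hm0 : (0 : ℝ) ≤ m := m.cast_nonneg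
    simp only [Complex.add_re, Complex.sub_re, Complex.natCast_re, Complex.div_ofNat_re,
      Complex.re_ofNat] at this ⊢
    push_cast
    linarith
  have hcoef : ∀ i, (i + σ) * (K * coeff lam γ ω a m i) ≠ 0 → rf (a (m + 1)) i ≠ 0 := by
    intro i hi
    refine ha i fun h0 => hi ?_
    rw [coeff_eq_zero h0, mul_zero, mul_zero]
  obtain ⟨h1, h2, h3⟩ := integral_tIntegrand ht hu hC (hc.linear_mul σ) hcoef w
  rw [hop]
  refine ⟨h1, h2, ?_⟩
  have hn : nested lam γ ω C f (m + 1) w = ∫ t in (0 : ℝ)..1, tIntegrand lam γ (m + 1) (C (m + 1))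
      (eulerOp lam ω (m + 1) (nested lam γ ω C f m)) w t := rfl
  rw [hn, hop, ← h3.tsum_eq, h3.summable.tsum_prod]
  -- The target coefficients are unfolded back into a double sum over `i` and `k = j - i`, to be
  -- matched term by term.
  simp only [mul_assoc K]
  rw [tsum_mul_left, ← h.tsum_coeff_mul_tsum_stepRatio ω a m (T := fun j => w ^ j) (K := 1)
    (Y := ‖w‖) (by simp), ← tsum_mul_left]
  congr 1
  ext i
  rw [← tsum_mul_left, ← tsum_mul_left]
  congr 1
  ext k
  by_cases h0 : rf (a (m + 1)) i = 0
  · have : rf (a m) i = 0 := by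
      by_contra h'
      exact ha i h' h0
    rw [coeff_eq_zero this]
    ring
  -- Splitting off the first factor of each Beta denominator exposes the denominators of
  -- `stepWeight`; what remains are the denominators of `stepRatio`.
  rw [h.stepRatio_add k h0, stepWeight, rf_succ', rf_succ']
  have e1 : ((m + 1 : ℕ) : ℂ) / 2 - 1 + lam / 2 + 1 + i = i + 1 / 2 + lam / 2 + m / 2 := by
    push_cast; ring
  have e2 : γ + ((m + 1 : ℕ) : ℂ) / 2 - 2 + lam / 2 + 1 + i = i - 1 / 2 + γ + m / 2 + lam / 2 := by
    push_cast; ring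
  have e3 : (i + 1 / 2 + lam / 2 + m / 2 + 1 : ℂ) = 1 + ((m + 1 : ℕ) : ℂ) / 2 + lam / 2 + i := by
    push_cast; ring
  have e4 : (i - 1 / 2 + γ + m / 2 + lam / 2 + 1 : ℂ) =
      ((m + 1 : ℕ) : ℂ) / 2 + γ + lam / 2 + i := by
    push_cast; ring
  have e5 : (i + σ : ℂ) = i + lam / 2 + ω / 2 + m / 2 := by rw [hσ]; push_cast; ring
  rw [e1, e2, e3, e4, e5]
  simp only [div_eq_mul_inv, mul_inv]
  ring

theorem Indicial.nested_eq (h : Indicial lam γ) {ω K : ℂ} {a : ℕ → ℂ}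
    {C : ℕ → ℂ → (ℂ → ℂ) → ℂ} {f : ℂ → ℂ}
    (hC : ∀ m, ContourSpec (C (m + 1)) (a (m + 1)))
    (ha : ∀ m i, rf (a m) i ≠ 0 → rf (a (m + 1)) i ≠ 0)
    (hf : ∀ w, f w = K * ∑' i, coeff lam γ ω a 0 i * w ^ i) (m : ℕ) :
    nested lam γ ω C f m = fun w => ∑' i, (K * coeff lam γ ω a m i) * w ^ i := by
  induction m with
  | zero =>
    funext w
    simp only [nested, hf, mul_assoc, tsum_mul_left]
  | succ m ih => exact funext fun w => (h.nested_succ (hC m) (ha m) ih w).2.2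

theorem Indicial.integralsConverge (h : Indicial lam γ) {ω K : ℂ} {a : ℕ → ℂ}
    {C : ℕ → ℂ → (ℂ → ℂ) → ℂ} {f : ℂ → ℂ}
    (hC : ∀ m, ContourSpec (C (m + 1)) (a (m + 1)))
    (ha : ∀ m i, rf (a m) i ≠ 0 → rf (a (m + 1)) i ≠ 0)
    (hf : ∀ w, f w = K * ∑' i, coeff lam γ ω a 0 i * w ^ i) :
    IntegralsConverge lam γ ω C f := by
  intro m
  have hm := h.nested_eq hC ha hf m
  refine ⟨?_, fun w => ?_⟩
  · rw [hm]
    exact ((h.expBound_coeff ω a m).const_mul K).differentiable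
  · have := h.nested_succ (hC m) (ha m) hm w
    exact ⟨this.1, this.2.1⟩

/-! ### The two indicial roots and the classical functions. -/

theorem Indicial.of_first (h : 1 / 2 < γ.re) : Indicial 0 γ :=
  ⟨by norm_num, by simpa using h, Or.inl rfl⟩

theorem Indicial.of_second (h : γ.re < 3 / 2) : Indicial (2 * (1 - γ)) γ := by
  have e : γ + 2 * (1 - γ) / 2 = 1 := by ring
  refine ⟨?_, by rw [e]; norm_num, Or.inr e⟩
  have e' : 1 + 2 * (1 - γ) / 2 = 2 - γ := by ring
  rw [e']
  simp only [Complex.sub_re, Complex.re_ofNat]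
  linarith

theorem startCoeff_first (γ a : ℂ) (i : ℕ) :
    startCoeff 0 γ a i = rf a i / (rf γ i * (i.factorial : ℂ)) := by
  simp [startCoeff, rf_one, mul_comm]

theorem startCoeff_second (γ a : ℂ) (i : ℕ) :
    startCoeff (2 * (1 - γ)) γ a i = rf a i / (rf (2 - γ) i * (i.factorial : ℂ)) := by
  have e : γ + 2 * (1 - γ) / 2 = 1 := by ring
  have e' : 1 + 2 * (1 - γ) / 2 = 2 - γ := by ring
  rw [startCoeff, e, e', rf_one]

theorem polyF_eq (ω : ℂ) (β : ℕ → ℕ) (γ w : ℂ) :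
    polyF (β 0) γ w =
      Complex.Gamma (β 0 + γ) / Complex.Gamma γ * polyTerm 0 γ ω β w 0 := by
  simp only [polyF, polyTerm, startCoeff_first]

theorem polyA_eq (ω : ℂ) (ψ : ℕ → ℕ) (γ w : ℂ) :
    polyA (ψ 0) γ w = Complex.Gamma (ψ 0 + 2 - γ) / Complex.Gamma (2 - γ) *
      polyTerm (2 * (1 - γ)) γ ω ψ w 0 := by
  simp only [polyA, polyTerm, startCoeff_second, mul_comm (rf (2 - γ) _)]

theorem kummerM_eq_first (ω q γ w : ℂ) : kummerM q γ w = infTerm 0 γ ω q w 0 := by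
  simp only [kummerM, infTerm, infStart, startCoeff_first, zero_div, add_zero]

theorem kummerM_eq_second (ω q γ w : ℂ) :
    kummerM (q + 1 - γ) (2 - γ) w = infTerm (2 * (1 - γ)) γ ω q w 0 := by
  have e : q + 2 * (1 - γ) / 2 = q + 1 - γ := by ring
  simp only [kummerM, infTerm, infStart, startCoeff_second, e]

/-- The polynomial case, for both indicial roots. -/
theorem Indicial.nested_polyContours (h : Indicial lam γ) {ω K : ℂ} {r : ℕ → ℝ}
    (hr : ∀ j, 0 < r j ∧ r j < 1) {β : ℕ → ℕ} (hβ : Monotone β) {f : ℂ → ℂ}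
    (hf : ∀ w, f w = K * polyTerm lam γ ω β w 0) :
    IntegralsConverge lam γ ω (polyContours r β) f ∧
      ∀ n w, nested lam γ ω (polyContours r β) f n w = K * polyTerm lam γ ω β w n := by
  have hC : ∀ m, ContourSpec (polyContours r β (m + 1)) (-(β (m + 1) : ℂ)) := fun m =>
    contourSpec_polyContour (hr _).1 (hr _).2 _
  have ha : ∀ m i, rf (-(β m : ℂ)) i ≠ 0 → rf (-(β (m + 1) : ℂ)) i ≠ 0 := fun m i hi => by
    rw [rf_neg_natCast_ne_zero_iff] at hi ⊢
    exact hi.trans (hβ m.le_succ)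
  simp only [h.polyTerm_eq] at hf ⊢
  refine ⟨h.integralsConverge (a := fun k => -(β k : ℂ)) hC ha hf, fun n w => ?_⟩
  rw [h.nested_eq (a := fun k => -(β k : ℂ)) hC ha hf n]
  simp only [mul_assoc, tsum_mul_left]

theorem Indicial.summable_polyTerm (h : Indicial lam γ) (ω : ℂ) {β : ℕ → ℕ}
    (hβ : BddAbove (Set.range β)) (z e : ℂ) :
    Summable fun n => polyTerm lam γ ω β z n * e ^ n := by
  obtain ⟨A, hA⟩ := hβ
  simp only [h.polyTerm_eq]
  refine h.summable_tsum_coeff ω (A := A) (fun k => ?_) z e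
  have : (β k : ℝ) ≤ A := by exact_mod_cast hA ⟨k, rfl⟩
  have hk : (0 : ℝ) ≤ k := k.cast_nonneg
  rw [norm_neg, Complex.norm_natCast]
  linarith

/-- The infinite series case, for both indicial roots. -/
theorem Indicial.nested_infContours (h : Indicial lam γ) {ω q : ℂ} {r : ℕ → ℝ}
    (hr : ∀ j, 0 < r j ∧ r j < 1) (hq : ∀ k m : ℕ, 1 ≤ k → q + k / 2 + lam / 2 ≠ -(m : ℂ))
    {f : ℂ → ℂ} (hf : ∀ w, f w = infTerm lam γ ω q w 0) :
    IntegralsConverge lam γ ω (infContours r lam q) f ∧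
      ∀ n w, nested lam γ ω (infContours r lam q) f n w = infTerm lam γ ω q w n := by
  have hC : ∀ m : ℕ, ContourSpec (infContours r lam q (m + 1))
      (q + ((m + 1 : ℕ) : ℂ) / 2 + lam / 2) := fun m =>
    contourSpec_infContour (hr _).1 (hr _).2 _
  -- Only parameters of index at least `1` must avoid the non-positive integers: `a_0` never occurs
  -- in a `stepRatio`.
  have ha : ∀ m i : ℕ, rf (q + (m : ℂ) / 2 + lam / 2) i ≠ 0 →
      rf (q + ((m + 1 : ℕ) : ℂ) / 2 + lam / 2) i ≠ 0 := fun m i _ => by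
    rw [rf_ne_zero_iff]
    exact fun x _ hx => hq (m + 1) x (by omega) (by linear_combination hx)
  simp only [h.infTerm_eq] at hf ⊢
  have hf' : ∀ w, f w = 1 * ∑' j, coeff lam γ ω (fun k => q + k / 2 + lam / 2) 0 j * w ^ j :=
    fun w => by rw [one_mul, hf]
  refine ⟨h.integralsConverge (a := fun k => q + k / 2 + lam / 2) hC ha hf', fun n w => ?_⟩
  rw [h.nested_eq (a := fun k => q + k / 2 + lam / 2) hC ha hf' n]
  simp only [one_mul]

theorem Indicial.summable_infTerm (h : Indicial lam γ) (ω q z e : ℂ) :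
    Summable fun n => infTerm lam γ ω q z n * e ^ n := by
  simp only [h.infTerm_eq]
  exact h.summable_tsum_coeff ω (norm_infParam_le lam q) z e

/-! ### Series as limits of partial sums, and assembly of the four cases. -/

theorem seriesTo_iff_tail {a : ℕ → ℂ} {y : ℂ} :
    SeriesTo a y ↔ ∃ s, SeriesTo (fun n => a (n + 1)) s ∧ y = a 0 + s := by
  have key : ∀ s, SeriesTo (fun n => a (n + 1)) s ↔ SeriesTo a (a 0 + s) := fun s => by
    unfold SeriesTo
    rw [← tendsto_add_atTop_iff_nat (f := fun N => ∑ n ∈ Finset.range N, a n) 1]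
    simp only [Finset.sum_range_succ', add_comm _ (a 0)]
    exact (tendsto_const_add_iff (a 0)).symm
  constructor
  · intro h
    refine ⟨y - a 0, (key _).2 ?_, by ring⟩
    rwa [add_sub_cancel]
  · rintro ⟨s, hs, rfl⟩
    exact (key s).1 hs

theorem SeriesTo.const_mul {a : ℕ → ℂ} {y : ℂ} (h : SeriesTo a y) (c : ℂ) :
    SeriesTo (fun n => c * a n) (c * y) := by
  unfold SeriesTo at h ⊢
  simp only [← Finset.mul_sum]
  exact h.const_mul c

theorem seriesTo_const_mul_of_tail {a : ℕ → ℂ} {c b s : ℂ} (h0 : a 0 = b)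
    (hs : SeriesTo (fun n => a (n + 1)) s) : SeriesTo (fun n => c * a n) (c * (b + s)) := by
  subst h0
  exact (seriesTo_iff_tail.2 ⟨s, hs, rfl⟩).const_mul c

theorem SeriesTo.exists_tail_of_const_mul {a : ℕ → ℂ} {c b y : ℂ} (h0 : a 0 = b) (hc : c ≠ 0)
    (hy : SeriesTo (fun n => c * a n) y) :
    ∃ s, SeriesTo (fun n => a (n + 1)) s ∧ y = c * (b + s) := by
  have h := hy.const_mul c⁻¹
  simp only [inv_mul_cancel_left₀ hc] at h
  obtain ⟨s, hs, hys⟩ := seriesTo_iff_tail.1 h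
  exact ⟨s, hs, by rw [← h0, ← hys, mul_inv_cancel_left₀ hc]⟩

/-- Form of the result for the infinite series, for both indicial roots. -/
theorem Indicial.infinite_series (h : Indicial lam γ) {ω q : ℂ} {r : ℕ → ℝ}
    (hr : ∀ j, 0 < r j ∧ r j < 1) (hq : ∀ k m : ℕ, 1 ≤ k → q + k / 2 + lam / 2 ≠ -(m : ℂ))
    {f : ℂ → ℂ} (hf : ∀ w, f w = infTerm lam γ ω q w 0) (c e z : ℂ) :
    InfSumsConverge lam γ ω q z ∧
      IntegralsConverge lam γ ω (infContours r lam q) f ∧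
      Summable (fun n => c * infTerm lam γ ω q z n * e ^ n) ∧
      Summable (fun n => nested lam γ ω (infContours r lam q) f (n + 1) z * e ^ (n + 1)) ∧
      (∑' n, c * infTerm lam γ ω q z n * e ^ n) =
        c * (f z + ∑' n, nested lam γ ω (infContours r lam q) f (n + 1) z * e ^ (n + 1)) ∧
      (∀ n, 1 ≤ n → c * infTerm lam γ ω q z n * e ^ n =
        c * (nested lam γ ω (infContours r lam q) f n z * e ^ n)) := by
  obtain ⟨h1, h2⟩ := h.nested_infContours hr hq hf
  have hs := h.summable_infTerm ω q z e
  simp only [h2, mul_assoc c, tsum_mul_left]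
  refine ⟨h.infSumsConverge ω q z, h1, hs.mul_left c, (summable_nat_add_iff 1).2 hs, ?_,
    fun n _ => trivial⟩
  rw [hs.tsum_eq_zero_add, hf]
  simp

end GCH

theorem mainTheorem5 (μ ε ν ω x : ℂ) (hμ : μ ≠ 0)
    (γ εt z : ℂ) (hγ : γ = (1 + ν) / 2) (hεt : εt = -(1 / 2) * ε * x)
    (hz : z = -(1 / 2) * μ * x ^ 2)
    (r : ℕ → ℝ) (hr : ∀ j, 0 < r j ∧ r j < 1) :
    -- polynomial of the first kind
    (1 / 2 < γ.re → ∀ (Ω : ℕ → ℂ) (β : ℕ → ℕ), Monotone β →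
      (∀ i, Ω i = -2 * μ * (β i + i / 2)) →
      GCH.IntegralsConverge 0 γ ω (GCH.polyContours r β) (GCH.polyF (β 0) γ) ∧
      GCH.QWpolyTerm β ω γ εt z 0 = GCH.polyF (β 0) γ z ∧
      (∀ n, 1 ≤ n → GCH.QWpolyTerm β ω γ εt z n =
        GCH.nested 0 γ ω (GCH.polyContours r β) (GCH.polyF (β 0) γ) n z * εt ^ n) ∧
      (∀ y, GCH.SeriesTo (GCH.QWpolyTerm β ω γ εt z) y ↔
        ∃ s, GCH.SeriesTo (fun n =>
            GCH.nested 0 γ ω (GCH.polyContours r β) (GCH.polyF (β 0) γ) (n + 1) z *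
              εt ^ (n + 1)) s ∧
          y = GCH.polyF (β 0) γ z + s) ∧
      (BddAbove (Set.range β) → Summable (GCH.QWpolyTerm β ω γ εt z))) ∧
    -- polynomial of the second kind
    (γ.re < 3 / 2 → ∀ (Ω : ℕ → ℂ) (ψ : ℕ → ℕ), Monotone ψ →
      (∀ i, Ω i = -2 * μ * (ψ i + 1 - γ + i / 2)) →
      GCH.IntegralsConverge (2 * (1 - γ)) γ ω (GCH.polyContours r ψ) (GCH.polyA (ψ 0) γ) ∧
      GCH.RWpolyTerm ψ ω γ εt z 0 = z ^ (1 - γ) * GCH.polyA (ψ 0) γ z ∧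
      (∀ n, 1 ≤ n → GCH.RWpolyTerm ψ ω γ εt z n = z ^ (1 - γ) *
        (GCH.nested (2 * (1 - γ)) γ ω (GCH.polyContours r ψ) (GCH.polyA (ψ 0) γ) n z *
          εt ^ n)) ∧
      (∀ s, GCH.SeriesTo (fun n =>
          GCH.nested (2 * (1 - γ)) γ ω (GCH.polyContours r ψ) (GCH.polyA (ψ 0) γ) (n + 1) z *
            εt ^ (n + 1)) s →
        GCH.SeriesTo (GCH.RWpolyTerm ψ ω γ εt z)
          (z ^ (1 - γ) * (GCH.polyA (ψ 0) γ z + s))) ∧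
      (z ^ (1 - γ) ≠ 0 → ∀ y, GCH.SeriesTo (GCH.RWpolyTerm ψ ω γ εt z) y →
        ∃ s, GCH.SeriesTo (fun n =>
            GCH.nested (2 * (1 - γ)) γ ω (GCH.polyContours r ψ) (GCH.polyA (ψ 0) γ) (n + 1) z *
              εt ^ (n + 1)) s ∧
          y = z ^ (1 - γ) * (GCH.polyA (ψ 0) γ z + s)) ∧
      (BddAbove (Set.range ψ) → Summable (GCH.RWpolyTerm ψ ω γ εt z))) ∧
    -- infinite series of the first kind
    (1 / 2 < γ.re → ∀ Ω : ℂ,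
      (∀ k m : ℕ, 1 ≤ k → Ω / (2 * μ) + k / 2 ≠ -(m : ℂ)) →
      (∀ m : ℕ, γ - Ω / (2 * μ) ≠ -(m : ℂ)) →
      GCH.InfSumsConverge 0 γ ω (Ω / (2 * μ)) z ∧
      GCH.IntegralsConverge 0 γ ω (GCH.infContours r 0 (Ω / (2 * μ)))
        (GCH.kummerM (Ω / (2 * μ)) γ) ∧
      Summable (GCH.QWTerm (Ω / (2 * μ)) ω γ εt z) ∧
      Summable (fun n => GCH.nested 0 γ ω (GCH.infContours r 0 (Ω / (2 * μ)))
        (GCH.kummerM (Ω / (2 * μ)) γ) (n + 1) z * εt ^ (n + 1)) ∧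
      (∑' n, GCH.QWTerm (Ω / (2 * μ)) ω γ εt z n) =
        Complex.Gamma (γ - Ω / (2 * μ)) / Complex.Gamma γ *
          (GCH.kummerM (Ω / (2 * μ)) γ z +
            ∑' n, GCH.nested 0 γ ω (GCH.infContours r 0 (Ω / (2 * μ)))
              (GCH.kummerM (Ω / (2 * μ)) γ) (n + 1) z * εt ^ (n + 1)) ∧
      (∀ n, 1 ≤ n → GCH.QWTerm (Ω / (2 * μ)) ω γ εt z n =
        Complex.Gamma (γ - Ω / (2 * μ)) / Complex.Gamma γ *
          (GCH.nested 0 γ ω (GCH.infContours r 0 (Ω / (2 * μ)))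
            (GCH.kummerM (Ω / (2 * μ)) γ) n z * εt ^ n))) ∧
    -- infinite series of the second kind
    (γ.re < 3 / 2 → ∀ Ω : ℂ,
      (∀ k m : ℕ, 1 ≤ k → Ω / (2 * μ) + 1 - γ + k / 2 ≠ -(m : ℂ)) →
      (∀ m : ℕ, 1 - Ω / (2 * μ) ≠ -(m : ℂ)) →
      GCH.InfSumsConverge (2 * (1 - γ)) γ ω (Ω / (2 * μ)) z ∧
      GCH.IntegralsConverge (2 * (1 - γ)) γ ω (GCH.infContours r (2 * (1 - γ)) (Ω / (2 * μ)))
        (GCH.kummerM (Ω / (2 * μ) + 1 - γ) (2 - γ)) ∧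
      Summable (GCH.RWTerm (Ω / (2 * μ)) ω γ εt z) ∧
      Summable (fun n => GCH.nested (2 * (1 - γ)) γ ω
        (GCH.infContours r (2 * (1 - γ)) (Ω / (2 * μ)))
        (GCH.kummerM (Ω / (2 * μ) + 1 - γ) (2 - γ)) (n + 1) z * εt ^ (n + 1)) ∧
      (∑' n, GCH.RWTerm (Ω / (2 * μ)) ω γ εt z n) =
        z ^ (1 - γ) * (Complex.Gamma (1 - Ω / (2 * μ)) / Complex.Gamma (2 - γ)) *
          (GCH.kummerM (Ω / (2 * μ) + 1 - γ) (2 - γ) z +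
            ∑' n, GCH.nested (2 * (1 - γ)) γ ω
              (GCH.infContours r (2 * (1 - γ)) (Ω / (2 * μ)))
              (GCH.kummerM (Ω / (2 * μ) + 1 - γ) (2 - γ)) (n + 1) z * εt ^ (n + 1)) ∧
      (∀ n, 1 ≤ n → GCH.RWTerm (Ω / (2 * μ)) ω γ εt z n =
        z ^ (1 - γ) * (Complex.Gamma (1 - Ω / (2 * μ)) / Complex.Gamma (2 - γ)) *
          (GCH.nested (2 * (1 - γ)) γ ω (GCH.infContours r (2 * (1 - γ)) (Ω / (2 * μ)))
            (GCH.kummerM (Ω / (2 * μ) + 1 - γ) (2 - γ)) n z * εt ^ n))) := by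
  refine ⟨fun hre Ω β hβ _ => ?_, fun hre Ω ψ hψ _ => ?_, fun hre Ω hq _ => ?_,
    fun hre Ω hq _ => ?_⟩
  · have h := GCH.Indicial.of_first hre
    obtain ⟨h1, h2⟩ := h.nested_polyContours hr hβ (GCH.polyF_eq ω β γ)
    have h0 : GCH.QWpolyTerm β ω γ εt z 0 = GCH.polyF (β 0) γ z := by
      rw [GCH.QWpolyTerm, pow_zero, mul_one, GCH.polyF_eq ω]
    have hn : ∀ n, GCH.QWpolyTerm β ω γ εt z n =
        GCH.nested 0 γ ω (GCH.polyContours r β) (GCH.polyF (β 0) γ) n z * εt ^ n :=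
      fun n => by rw [GCH.QWpolyTerm, h2]
    refine ⟨h1, h0, fun n _ => hn n, fun y => ?_, fun hb => ?_⟩
    -- The constant is contained in `polyF`, so the terms agree without a prefactor and the
    -- equivalence needs no division.
    · simp only [GCH.seriesTo_iff_tail (a := GCH.QWpolyTerm β ω γ εt z), h0, hn]
    · have hs := (h.summable_polyTerm ω hb z εt).mul_left
        (Complex.Gamma (β 0 + γ) / Complex.Gamma γ)
      exact hs.congr fun n => by rw [GCH.QWpolyTerm]; ring
  · have h := GCH.Indicial.of_second hre
    obtain ⟨h1, h2⟩ := h.nested_polyContours hr hψ (GCH.polyA_eq ω ψ γ)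
    have h0 : GCH.nested (2 * (1 - γ)) γ ω (GCH.polyContours r ψ) (GCH.polyA (ψ 0) γ) 0 z *
        εt ^ 0 = GCH.polyA (ψ 0) γ z := by rw [pow_zero, mul_one, GCH.nested]
    have hn : GCH.RWpolyTerm ψ ω γ εt z = fun n => z ^ (1 - γ) *
        (GCH.nested (2 * (1 - γ)) γ ω (GCH.polyContours r ψ) (GCH.polyA (ψ 0) γ) n z *
          εt ^ n) := by
      funext n
      rw [GCH.RWpolyTerm, h2]
      ring
    refine ⟨h1, ?_, fun n _ => congrFun hn n, fun s hs => ?_, fun hz0 y hy => ?_, fun hb => ?_⟩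
    · rw [congrFun hn 0, h0]
    · rw [hn]
      exact GCH.seriesTo_const_mul_of_tail (a := fun n => GCH.nested (2 * (1 - γ)) γ ω
        (GCH.polyContours r ψ) (GCH.polyA (ψ 0) γ) n z * εt ^ n) h0 hs
    -- Recovering convergence of the inner series means dividing by `z ^ (1 - γ)`.
    · rw [hn] at hy
      exact GCH.SeriesTo.exists_tail_of_const_mul (a := fun n => GCH.nested (2 * (1 - γ)) γ ω
        (GCH.polyContours r ψ) (GCH.polyA (ψ 0) γ) n z * εt ^ n) h0 hz0 hy
    · have hs := (h.summable_polyTerm ω hb z εt).mul_left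
        (z ^ (1 - γ) * (Complex.Gamma (ψ 0 + 2 - γ) / Complex.Gamma (2 - γ)))
      exact hs.congr fun n => by rw [GCH.RWpolyTerm]; ring
  · exact (GCH.Indicial.of_first hre).infinite_series hr
      (fun k m hk => by simpa using hq k m hk) (GCH.kummerM_eq_first ω (Ω / (2 * μ)) γ) _ εt z
  · exact (GCH.Indicial.of_second hre).infinite_series hr
      (fun k m hk h => hq k m hk (by linear_combination h))
      (GCH.kummerM_eq_second ω (Ω / (2 * μ)) γ) _ εt z
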